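/- **Notation.** For $\mu\ge 0$ let $(\mu)_0=1$, $(\mu)_n=\mu(\mu+1)\cdots(\mu+n-1)$. For a family of power series $F(\mu;x)$, $\mu\ge0$, put $$\Delta_F(\alpha,\beta;x)=F(\mu+\alpha;x)F(\mu+\beta;x)-F(\mu;x)F(\mu+\alpha+\beta;x).$$ $\mu\mapsto F(\mu;x)$ is called *coefficient-wise log-concave* (*log-convex*) on $[0,\infty)$ if for all $\mu,\alpha,\beta\ge0$ all coefficients of the formal power series $\Delta_F(\alpha,\beta;x)$ are $\ge0$ ($\le0$); it is so *for shifts in a set* $S$ if this holds for all $\mu\ge0$ and $(\alpha,\beta)\in S$. It is called *log-concave* (*log-convex*) *for integer shifts* if $\Delta_F(\alpha,\beta;x)\ge0$ ($\le0$) for all $\mu\ge0$, all nonnegative integers $\alpha,\beta$ and all $x\ge0$ at which the four series involved converge. Let $p,q\ge0$, let $A_1,\dots,A_p$, $a_1,\dots,a_p$, $B_1,\dots,B_q$, $b_1,\dots,b_q$ and $\theta$ be positive reals, write $\Gamma(\mathbf An+\mathbf a)=\prod_{i=1}^p\Gamma(A_in+a_i)$, $\Gamma(\mathbf Bn+\mathbf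 b)=\prod_{j=1}^q\Gamma(B_jn+b_j)$, and set $$V(n)=\frac{\Gamma(\mathbf An+\mathbf a)}{\theta^n\,\Gamma(\mathbf Bn+\mathbf b)}.$$ **Theorem.** Let $$\text{(N)}\qquad \sum_{j=1}^qB_j=\sum_{i=1}^pA_i,\qquad \prod_{i=1}^pA_i^{A_i}\prod_{j=1}^qB_j^{-B_j}\le\theta,$$ and suppose that at least one of the following holds: 1. (N), and $\displaystyle\sum_{i=1}^p\frac{e^{-a_iu/A_i}}{1-e^{-u/A_i}}-\sum_{j=1}^q\frac{e^{-b_ju/B_j}}{1-e^{-u/B_j}}\ge0$ for all $u>0$; 2. (N), and $b_j>1$ and $\displaystyle\sum_{k=1}^qB_k\ge\frac{B_j}{b_j-1}\sum_{k=1}^pa_k$ for $j=1,\dots,q$; 3. (N), and there are $\omega_1,\dots,\omega_p\ge0$ with $\sum_i\omega_i=1$, $A_i\ge\omega_i\sum_{j=1}^qB_j$ for $i=1,\dots,p$, and $\displaystyle\frac{b_j-1}{B_j}\ge\sum_{i=1}^p\frac{\omega_ia_i}{A_i}$ for $j=1,\dots,q$; 4. there are positive integers $\alpha_1\le\dots\le\alpha_r$,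 $\beta_1\le\dots\le\beta_r$ with $\sum_{j\le k}\alpha_j\le\sum_{j\le k}\beta_j$ for $k=1,\dots,r$, and a number $c\ge1$, such that, up to order, $\mathbf A$ consists of $\alpha_j$ copies of $1/\alpha_j$ and $\mathbf B$ of $\beta_j$ copies of $1/\beta_j$ ($j=1,\dots,r$), all $a_i$ and $b_j$ equal $c$, and $\theta=\prod_{j=1}^r\beta_j/\alpha_j$; that is, $V(n)=\theta^{-n}\prod_{j=1}^r\Gamma(n/\alpha_j+c)^{\alpha_j}/\Gamma(n/\beta_j+c)^{\beta_j}$. Then: * $\displaystyle g(\mu;x)=\sum_{n\ge0}\frac{\Gamma(\mathbf An+\mathbf a)}{\Gamma(\mathbf Bn+\mathbf b)}\frac{(\mu)_{2n}}{(2n)!}\Big(\frac x\theta\Big)^n$ is coefficient-wise log-convex on $[0,\infty)$; * $\displaystyle f(\mu;x)=\sum_{n\ge1}\frac{(\mu)_{2n}}{V(n-1)\,(2n-1)!}x^n$ is coefficient-wise log-concave on $[0,\infty)$; * $\displaystyle h(\mu;x)=\sum_{n\ge0}\frac{\Gamma(\mathbf Bn+\mathbf b)}{\Gamma(\mathbf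 An+\mathbf a)}\frac{(\mu)_{2n}}{(\mu+1)_n\,n!}(\theta x)^n$ is coefficient-wise log-concave on $[0,\infty)$ for integer shifts $\alpha,\beta\ge0$ with $\alpha+\beta\le4$, and log-concave for integer shifts; * $\displaystyle\hat h(\mu;x)=\sum_{n\ge0}\frac{\Gamma(\mathbf An+\mathbf a)}{\Gamma(\mathbf Bn+\mathbf b)}\frac{(\mu)_{2n}}{(\mu+1)_n\,n!}\Big(\frac x\theta\Big)^n$ is coefficient-wise log-convex on $[0,\infty)$ for integer shifts $\alpha,\beta\ge0$ with $\alpha+\beta\le4$, and log-convex for integer shifts. -/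

import Mathlib

noncomputable section

namespace FoxWrightTuran

/-! ### Generalized Turanians of families of formal power series -/

/-- The generalized Turanian `F(μ+α) F(μ+β) - F(μ) F(μ+α+β)` of a family `μ ↦ F(μ; x)` of formal
power series in `x`. -/
def turanian (F : ℝ → PowerSeries ℝ) (μ α β : ℝ) : PowerSeries ℝ :=
  F (μ + α) * F (μ + β) - F μ * F (μ + α + β)

/-- `μ ↦ F(μ; x)` is coefficient-wise log-concave on `[0, ∞)` for shifts `(α, β)` in
`S ⊆ [0, ∞)²`. -/
def CoeffwiseLogConcaveForShifts (F : ℝ → PowerSeries ℝ) (S : Set (ℝ × ℝ)) : Prop :=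
  ∀ μ α β : ℝ, 0 ≤ μ → 0 ≤ α → 0 ≤ β → (α, β) ∈ S →
    ∀ k : ℕ, 0 ≤ PowerSeries.coeff k (turanian F μ α β)

/-- `μ ↦ F(μ; x)` is coefficient-wise log-convex on `[0, ∞)` for shifts `(α, β)` in
`S ⊆ [0, ∞)²`. -/
def CoeffwiseLogConvexForShifts (F : ℝ → PowerSeries ℝ) (S : Set (ℝ × ℝ)) : Prop :=
  ∀ μ α β : ℝ, 0 ≤ μ → 0 ≤ α → 0 ≤ β → (α, β) ∈ S →
    ∀ k : ℕ, PowerSeries.coeff k (turanian F μ α β) ≤ 0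

/-- Coefficient-wise log-concavity on `[0, ∞)`: all nonnegative shifts. -/
def CoeffwiseLogConcave (F : ℝ → PowerSeries ℝ) : Prop :=
  CoeffwiseLogConcaveForShifts F Set.univ

/-- Coefficient-wise log-convexity on `[0, ∞)`: all nonnegative shifts. -/
def CoeffwiseLogConvex (F : ℝ → PowerSeries ℝ) : Prop :=
  CoeffwiseLogConvexForShifts F Set.univ

/-- The power series `f` converges at the point `x`. -/
def ConvergesAt (f : PowerSeries ℝ) (x : ℝ) : Prop :=
  Summable fun n : ℕ => PowerSeries.coeff n f * x ^ n

/-- The sum of the power series `f` at the point `x`. -/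
def sumAt (f : PowerSeries ℝ) (x : ℝ) : ℝ :=
  ∑' n : ℕ, PowerSeries.coeff n f * x ^ n

/-- For every fixed `x ≥ 0` the function `μ ↦ F(μ; x)` is log-concave on `[0, ∞)` for shifts
`(α, β)` in `S`, that is, its Turanian is nonnegative wherever the series involved converge. -/
def LogConcaveForShifts (F : ℝ → PowerSeries ℝ) (S : Set (ℝ × ℝ)) : Prop :=
  ∀ x μ α β : ℝ, 0 ≤ x → 0 ≤ μ → 0 ≤ α → 0 ≤ β → (α, β) ∈ S →
    ConvergesAt (F μ) x → ConvergesAt (F (μ + α)) x → ConvergesAt (F (μ + β)) x →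
    ConvergesAt (F (μ + α + β)) x →
    0 ≤ sumAt (F (μ + α)) x * sumAt (F (μ + β)) x - sumAt (F μ) x * sumAt (F (μ + α + β)) x

/-- For every fixed `x ≥ 0` the function `μ ↦ F(μ; x)` is log-convex on `[0, ∞)` for shifts
`(α, β)` in `S`, that is, its Turanian is nonpositive wherever the series involved converge. -/
def LogConvexForShifts (F : ℝ → PowerSeries ℝ) (S : Set (ℝ × ℝ)) : Prop :=
  ∀ x μ α β : ℝ, 0 ≤ x → 0 ≤ μ → 0 ≤ α → 0 ≤ β → (α, β) ∈ S →
    ConvergesAt (F μ) x → ConvergesAt (F (μ + α)) x → ConvergesAt (F (μ + β)) x →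
    ConvergesAt (F (μ + α + β)) x →
    sumAt (F (μ + α)) x * sumAt (F (μ + β)) x - sumAt (F μ) x * sumAt (F (μ + α + β)) x ≤ 0

/-- All integer shifts. -/
def integerShifts : Set (ℝ × ℝ) :=
  {s | ∃ m n : ℕ, s = ((m : ℝ), (n : ℝ))}

/-- Integer shifts with sum at most `4`. -/
def integerShiftsSumLeFour : Set (ℝ × ℝ) :=
  {s | ∃ m n : ℕ, m + n ≤ 4 ∧ s = ((m : ℝ), (n : ℝ))}

/-! ### The series -/

/-- The rising factorial `(μ)_n = μ (μ + 1) ⋯ (μ + n - 1)`. -/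
def rising (μ : ℝ) (n : ℕ) : ℝ := (ascPochhammer ℝ n).eval μ

/-- `Γ(A n + a) = ∏ i, Γ(A i * n + a i)`. -/
def gammaProd {p : ℕ} (A a : Fin p → ℝ) (n : ℕ) : ℝ :=
  ∏ i, Real.Gamma (A i * n + a i)

/-- `V(n) = Γ(A n + a) / (θ ^ n Γ(B n + b))`. -/
def V {p q : ℕ} (A a : Fin p → ℝ) (B b : Fin q → ℝ) (θ : ℝ) (n : ℕ) : ℝ :=
  gammaProd A a n / (θ ^ n * gammaProd B b n)

/-- `g(μ; x) = ∑_{n ≥ 0} Γ(A n + a) / Γ(B n + b) * (μ)_{2n} / (2n)! * (x / θ) ^ n`. -/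
def gSeries {p q : ℕ} (A a : Fin p → ℝ) (B b : Fin q → ℝ) (θ : ℝ) (μ : ℝ) : PowerSeries ℝ :=
  PowerSeries.mk fun n =>
    gammaProd A a n / gammaProd B b n * (rising μ (2 * n) / (2 * n).factorial) * (1 / θ) ^ n

/-- `f(μ; x) = ∑_{n ≥ 1} (μ)_{2n} / (V(n-1) (2n-1)!) * x ^ n`. -/
def fSeries {p q : ℕ} (A a : Fin p → ℝ) (B b : Fin q → ℝ) (θ : ℝ) (μ : ℝ) : PowerSeries ℝ :=
  PowerSeries.mk fun n =>
    if n = 0 then 0 else rising μ (2 * n) / (V A a B b θ (n - 1) * (2 * n - 1).factorial)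

/-- `h(μ; x) = ∑_{n ≥ 0} Γ(B n + b) / Γ(A n + a) * (μ)_{2n} / ((μ+1)_n n!) * (θ x) ^ n`. -/
def hSeries {p q : ℕ} (A a : Fin p → ℝ) (B b : Fin q → ℝ) (θ : ℝ) (μ : ℝ) : PowerSeries ℝ :=
  PowerSeries.mk fun n =>
    gammaProd B b n / gammaProd A a n *
      (rising μ (2 * n) / (rising (μ + 1) n * n.factorial)) * θ ^ n

/-- `ĥ(μ; x) = ∑_{n ≥ 0} Γ(A n + a) / Γ(B n + b) * (μ)_{2n} / ((μ+1)_n n!) * (x / θ) ^ n`. -/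
def hHatSeries {p q : ℕ} (A a : Fin p → ℝ) (B b : Fin q → ℝ) (θ : ℝ) (μ : ℝ) : PowerSeries ℝ :=
  PowerSeries.mk fun n =>
    gammaProd A a n / gammaProd B b n *
      (rising μ (2 * n) / (rising (μ + 1) n * n.factorial)) * (1 / θ) ^ n

/-! ### Conditions on the parameters -/

/-- `∑ B = ∑ A` and `ρ = ∏ A_i ^ A_i ∏ B_j ^ (-B_j) ≤ θ`. -/
def BalancedParameters {p q : ℕ} (A : Fin p → ℝ) (B : Fin q → ℝ) (θ : ℝ) : Prop :=
  ∑ j, B j = ∑ i, A i ∧ (∏ i, A i ^ A i) * (∏ j, B j ^ (-B j)) ≤ θ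

/-- `P(u) ≥ 0` for all `u > 0`. -/
def KernelNonneg {p q : ℕ} (A a : Fin p → ℝ) (B b : Fin q → ℝ) : Prop :=
  ∀ u : ℝ, 0 < u →
    0 ≤ ∑ i, Real.exp (-a i * u / A i) / (1 - Real.exp (-u / A i)) -
      ∑ j, Real.exp (-b j * u / B j) / (1 - Real.exp (-u / B j))

/-- `∑_k B_k ≥ B_j / (b_j - 1) * ∑_k a_k` for every `j`, with `b_j > 1`. -/
def SumCondition {p q : ℕ} (a : Fin p → ℝ) (B b : Fin q → ℝ) : Prop :=
  ∀ j, 1 < b j ∧ B j / (b j - 1) * ∑ k, a k ≤ ∑ k, B k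

/-- For some weights `ω_i ≥ 0` with sum `1`: `A_i ≥ ω_i ∑_j B_j` for every `i`, and
`(b_j - 1) / B_j ≥ ∑_i ω_i a_i / A_i` for every `j`. -/
def WeightCondition {p q : ℕ} (A a : Fin p → ℝ) (B b : Fin q → ℝ) : Prop :=
  ∃ ω : Fin p → ℝ, (∀ i, 0 ≤ ω i) ∧ ∑ i, ω i = 1 ∧
    (∀ i, ω i * ∑ j, B j ≤ A i) ∧ ∀ j, ∑ i, ω i * a i / A i ≤ (b j - 1) / B j

/-- There are positive integers `α_1 ≤ ⋯ ≤ α_r` and `β_1 ≤ ⋯ ≤ β_r` with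
`∑_{j ≤ k} α_j ≤ ∑_{j ≤ k} β_j` for every `k`, such that, up to the order of the factors, `A`
consists of `α_j` copies of `1 / α_j` and `B` of `β_j` copies of `1 / β_j` (`j = 1, …, r`), all
`a_i` and `b_j` equal one number `c ≥ 1`, and `θ = ∏ β_j / α_j`; in other words
`V(n) = θ ^ (-n) ∏_j Γ(n / α_j + c) ^ α_j / Γ(n / β_j + c) ^ β_j`. -/
def BlockCondition {p q : ℕ} (A a : Fin p → ℝ) (B b : Fin q → ℝ) (θ : ℝ) : Prop :=
  ∃ (r : ℕ) (α β : Fin r → ℕ) (c : ℝ)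
    (e₁ : (Σ j, Fin (α j)) ≃ Fin p) (e₂ : (Σ j, Fin (β j)) ≃ Fin q),
    (∀ j, 0 < α j) ∧ (∀ j, 0 < β j) ∧ Monotone α ∧ Monotone β ∧
    (∀ k, ∑ j ∈ Finset.Iic k, α j ≤ ∑ j ∈ Finset.Iic k, β j) ∧
    1 ≤ c ∧ (∀ i, a i = c) ∧ (∀ j, b j = c) ∧
    (∀ s, A (e₁ s) = 1 / (α s.1 : ℝ)) ∧ (∀ s, B (e₂ s) = 1 / (β s.1 : ℝ)) ∧
    θ = ∏ j, (β j : ℝ) / (α j : ℝ)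

/-- One of the four sets of conditions on the parameters holds. -/
def ParameterConditions {p q : ℕ} (A a : Fin p → ℝ) (B b : Fin q → ℝ) (θ : ℝ) : Prop :=
  (BalancedParameters A B θ ∧ KernelNonneg A a B b) ∨
  (BalancedParameters A B θ ∧ SumCondition a B b) ∨
  (BalancedParameters A B θ ∧ WeightCondition A a B b) ∨
  BlockCondition A a B b θ

end FoxWrightTuran

end

/-!
Write `v n = V(n)`. The parameters enter the theorem only through one property of `v`: it is a
Stieltjes moment sequence, or rather (which is all that is needed, since every coefficient of a
Turánian involves finitely many `v n` and depends on them continuously) it lies in the closure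
`momentCone` of the moment sequences of finitely supported measures on `[0, ∞)`.

*The moment property* (`V_mem_momentCone`). All four sets of conditions imply that the kernel
`P(u) = ∑ e^{-aᵢu/Aᵢ} / (1 - e^{-u/Aᵢ}) - ∑ e^{-bⱼu/Bⱼ} / (1 - e^{-u/Bⱼ})` is nonnegative
(`kernelNonneg_of_parameterConditions`): the second is a case of the third, which follows from
Jensen's inequality, and the fourth follows from weak majorization, as `y / (e^y - 1)` is
decreasing and convex. Expanding `P` in geometric series, Frullani's integral and Euler's limit
for `Γ` show that `log v n` is an affine function of `n` plus `∫₀^∞ (e^{-nu} - 1 + n (1 - e^{-u}))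
P(u) du/u`. The exponential of an affine function is a geometric sequence, `exp (s e^{-nu})` is a
limit of moment sequences, and these are closed under products and limits; hence `v` lies in the
cone. In particular `v` is log-convex.

*Log-convexity of `g` and `ĥ`.* For `v n = tⁿ` both families are built from exponential families
`μ ↦ φ ^ μ` of power series: `φ = 1 / (1 ∓ √(t x))` for `g`, and `φ = C(t x)`, with `C` the
generating function of the Catalan numbers, for `ĥ`. For a mixture `∑ wᵢ φᵢ ^ μ` twice the
Turánian is `-∑ wᵢ wⱼ (φᵢ φⱼ) ^ μ (φᵢ ^ α - φⱼ ^ α) (φᵢ ^ β - φⱼ ^ β)` (`turanian_sum_smul`), and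
each summand has nonnegative coefficients (only the even powers of `√x` matter in the case of
`g`).

*Log-concavity of `f` and `h`.* Here the weights are `u n = 1 / v n`, which are log-concave. For
unit weights the Turánian is nonnegative (`coeff_turanian_evenRising_one_nonneg`), respectively
zero. The symmetrized terms `(k, l)`, `k + l = N`, of its `N`-th coefficient, ordered by `k l`,
change sign only once, from `-` to `+`, and `u k * u l` increases with `k l`; so the weights
preserve nonnegativity (`coeff_turanian_nonneg_of_sign_change`). For `f` the single sign change is
a monotonicity property of rising factorials (`risingTerm_step`). For `h` and integer shifts with
sum at most `4` the sign of the term is that of an explicit polynomial in `k l` with at most one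
sign change among its coefficients (`CatFormSign`). The shifts `(1, 1)` make `j ↦ h(μ + j; x)` a
log-concave sequence, which yields all integer shifts at a point.
-/

noncomputable section

namespace FoxWrightTuran

open Polynomial PowerSeries Finset

/-! ### Rising factorials and convolution families of polynomials -/

lemma rising_zero (μ : ℝ) : rising μ 0 = 1 := by simp [rising]

lemma rising_succ (μ : ℝ) (n : ℕ) : rising μ (n + 1) = rising μ n * (μ + n) := by
  simp [rising, ascPochhammer_succ_eval]

lemma rising_succ_left (μ : ℝ) (n : ℕ) : rising μ (n + 1) = μ * rising (μ + 1) n := by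
  simp [rising, ascPochhammer_succ_left, Polynomial.eval_comp]

lemma rising_add (μ : ℝ) (m n : ℕ) : rising μ (m + n) = rising μ m * rising (μ + m) n := by
  induction n with
  | zero => simp [rising_zero]
  | succ n ih => rw [← add_assoc, rising_succ, ih, rising_succ]; push_cast; ring

lemma rising_nonneg {μ : ℝ} (h : 0 ≤ μ) (n : ℕ) : 0 ≤ rising μ n := by
  induction n with
  | zero => simp [rising_zero]
  | succ n ih => rw [rising_succ]; positivity

lemma rising_pos {μ : ℝ} (h : 0 < μ) (n : ℕ) : 0 < rising μ n := by
  induction n with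
  | zero => simp [rising_zero]
  | succ n ih => rw [rising_succ]; positivity

lemma rising_mono {μ ν : ℝ} (h : 0 ≤ μ) (hν : μ ≤ ν) (n : ℕ) : rising μ n ≤ rising ν n := by
  induction n with
  | zero => simp [rising_zero]
  | succ n ih =>
    rw [rising_succ, rising_succ]
    have := rising_nonneg (h.trans hν) n
    gcongr

lemma continuous_rising (n : ℕ) : Continuous fun μ => rising μ n :=
  (ascPochhammer ℝ n).continuous

/-- A sequence of polynomials with `c₀ = 1`, `cₙ₊₁(0) = 0` and the first-order difference equation
`cₙ₊₁(x + 1) = cₙ₊₁(x) + cₙ(x + 1 + s)` is of convolution type, that is, `∑ cₙ(x) yⁿ` is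
exponential in `x`. Both sides of the convolution identity have the same differences in `x` and
the same value at `0`, so their difference is a polynomial vanishing on `ℕ`. -/
lemma sum_antidiagonal_eval_mul_eval {s : ℝ} {c : ℕ → ℝ[X]} (h0 : c 0 = 1)
    (hz : ∀ n, (c (n + 1)).eval 0 = 0)
    (hr : ∀ n x, (c (n + 1)).eval (x + 1) = (c (n + 1)).eval x + (c n).eval (x + 1 + s))
    (n : ℕ) (x y : ℝ) :
    ∑ p ∈ antidiagonal n, (c p.1).eval x * (c p.2).eval y = (c n).eval (x + y) := by
  induction n generalizing x y with
  | zero => simp [h0]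
  | succ n ih =>
    let p : ℝ[X] := ∑ q ∈ antidiagonal (n + 1), c q.1 * Polynomial.C ((c q.2).eval y) -
      (c (n + 1)).comp (Polynomial.X + Polynomial.C y)
    have hp : ∀ x, p.eval x = ∑ q ∈ antidiagonal (n + 1), (c q.1).eval x * (c q.2).eval y -
        (c (n + 1)).eval (x + y) := by
      intro x
      simp [p, Polynomial.eval_finsetSum, Polynomial.eval_comp]
    have hstep : ∀ x, p.eval (x + 1) = p.eval x := by
      intro x
      have e1 := ih (x + 1 + s) y
      have e2 := hr n (x + y)
      rw [hp, hp, Finset.Nat.sum_antidiagonal_succ, Finset.Nat.sum_antidiagonal_succ]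
      simp only [h0, Polynomial.eval_one, hr, add_mul, Finset.sum_add_distrib]
      rw [e1, show x + 1 + y = x + y + 1 by ring, e2,
        show x + 1 + s + y = x + y + 1 + s by ring]
      ring
    have hzero : p.eval 0 = 0 := by
      rw [hp, Finset.Nat.sum_antidiagonal_succ]
      simp [h0, hz]
    have hnat : ∀ k : ℕ, p.eval (k : ℝ) = 0 := by
      intro k
      induction k with
      | zero => simpa using hzero
      | succ k ihk => push_cast; rw [hstep, ihk]
    have hp0 : p = 0 := Polynomial.eq_zero_of_infinite_isRoot p
      ((Set.infinite_range_of_injective Nat.cast_injective).mono (by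
        rintro _ ⟨k, rfl⟩
        exact hnat k))
    have := hp x
    rw [hp0, Polynomial.eval_zero] at this
    linarith

/-- The Taylor coefficients `(x)ₙ / n!` of `(1 - y) ^ (-x)`, as polynomials in `x`. -/
def binomPoly (n : ℕ) : ℝ[X] := Polynomial.C (1 / (n.factorial : ℝ)) * ascPochhammer ℝ n

lemma binomPoly_eval (n : ℕ) (x : ℝ) : (binomPoly n).eval x = rising x n / n.factorial := by
  simp [binomPoly, rising]; ring

lemma sum_binomPoly (n : ℕ) (x y : ℝ) :
    ∑ p ∈ antidiagonal n, (binomPoly p.1).eval x * (binomPoly p.2).eval y =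
      (binomPoly n).eval (x + y) := by
  refine sum_antidiagonal_eval_mul_eval (s := 0) (by simp [binomPoly]) (fun n => ?_)
    (fun n x => ?_) n x y
  · rw [binomPoly_eval, rising_succ_left]; simp
  · simp only [binomPoly_eval, add_zero]
    rw [rising_succ (x + 1), rising_succ_left x, Nat.factorial_succ]
    have : (n.factorial : ℝ) ≠ 0 := by positivity
    push_cast
    field_simp
    ring

/-- The Taylor coefficients `x (x + n + 1)ₙ₋₁ / n!` of `C(y) ^ x`, with `C` the generating
function of the Catalan numbers, as polynomials in `x`. -/
def catPoly : ℕ → ℝ[X]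
  | 0 => 1
  | n + 1 => Polynomial.C (1 / ((n + 1).factorial : ℝ)) *
      (Polynomial.X * (ascPochhammer ℝ n).comp (Polynomial.X + Polynomial.C ((n : ℝ) + 2)))

lemma catPoly_zero_eval (x : ℝ) : (catPoly 0).eval x = 1 := by simp [catPoly]

lemma catPoly_succ_eval (n : ℕ) (x : ℝ) :
    (catPoly (n + 1)).eval x = x * rising (x + n + 2) n / (n + 1).factorial := by
  simp [catPoly, rising, Polynomial.eval_comp, add_assoc]; ring

/-- The Rothe–Hagen identity for the powers of the Catalan generating function. -/
lemma sum_catPoly (n : ℕ) (x y : ℝ) :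
    ∑ p ∈ antidiagonal n, (catPoly p.1).eval x * (catPoly p.2).eval y =
      (catPoly n).eval (x + y) := by
  refine sum_antidiagonal_eval_mul_eval (s := 1) (by simp [catPoly]) (fun n => ?_)
    (fun n x => ?_) n x y
  · rw [catPoly_succ_eval]; simp
  · cases n with
    | zero => simp [catPoly_succ_eval, catPoly_zero_eval, rising_zero]
    | succ n =>
      simp only [catPoly_succ_eval]
      rw [rising_succ (x + 1 + _ + 2), rising_succ_left (x + _ + 2), Nat.factorial_succ (n + 1)]
      have : ((n + 1).factorial : ℝ) ≠ 0 := by positivity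
      push_cast
      rw [show x + 1 + ((n : ℝ) + 1) + 2 = x + n + 4 by ring,
        show x + ((n : ℝ) + 1) + 2 + 1 = x + n + 4 by ring,
        show x + 1 + 1 + (n : ℝ) + 2 = x + n + 4 by ring]
      field_simp
      ring

lemma catPoly_eval {x : ℝ} (hx : 0 ≤ x) (n : ℕ) :
    (catPoly n).eval x = rising x (2 * n) / (rising (x + 1) n * n.factorial) := by
  cases n with
  | zero => simp [catPoly_zero_eval, rising_zero]
  | succ n =>
    rw [catPoly_succ_eval, show 2 * (n + 1) = (n + 1 + n) + 1 by ring, rising_succ_left,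
      rising_add]
    have h1 := rising_pos (show 0 < x + 1 by linarith) (n + 1)
    have : ((n + 1).factorial : ℝ) ≠ 0 := by positivity
    push_cast
    rw [show x + 1 + ((n : ℝ) + 1) = x + n + 2 by ring]
    field_simp

/-! ### Power series with nonnegative coefficients -/

/-- All coefficients of the power series are nonnegative. -/
def CoeffNonneg (F : ℝ⟦X⟧) : Prop := ∀ n, 0 ≤ PowerSeries.coeff n F

lemma CoeffNonneg.add {F G : ℝ⟦X⟧} (hF : CoeffNonneg F) (hG : CoeffNonneg G) :
    CoeffNonneg (F + G) := fun n => by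
  rw [map_add]; exact add_nonneg (hF n) (hG n)

lemma CoeffNonneg.mul {F G : ℝ⟦X⟧} (hF : CoeffNonneg F) (hG : CoeffNonneg G) :
    CoeffNonneg (F * G) := fun n => by
  rw [PowerSeries.coeff_mul]
  exact Finset.sum_nonneg fun p _ => mul_nonneg (hF _) (hG _)

lemma CoeffNonneg.smul {c : ℝ} {F : ℝ⟦X⟧} (hc : 0 ≤ c) (hF : CoeffNonneg F) :
    CoeffNonneg (c • F) := fun n => by
  rw [map_smul]; exact mul_nonneg hc (hF n)

/-- A solution of `W' = H W` with `H` and `W(0)` nonnegative has nonnegative coefficients. -/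
lemma coeffNonneg_of_derivative_eq_mul {W H : ℝ⟦X⟧} (hH : CoeffNonneg H)
    (h0 : 0 ≤ PowerSeries.coeff 0 W) (hW : PowerSeries.derivative ℝ W = H * W) :
    CoeffNonneg W := by
  intro n
  induction n using Nat.strong_induction_on with
  | _ n ih =>
    cases n with
    | zero => exact h0
    | succ n =>
      have h := congrArg (PowerSeries.coeff n) hW
      rw [PowerSeries.coeff_derivative, PowerSeries.coeff_mul] at h
      have h2 : 0 ≤ PowerSeries.coeff (n + 1) W * ((n : ℝ) + 1) := by
        rw [h]
        exact Finset.sum_nonneg fun p hp => mul_nonneg (hH _) (ih _ (by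
          have := HasAntidiagonal.mem_antidiagonal.mp hp
          omega))
      exact nonneg_of_mul_nonneg_left h2 (by positivity)

/-- `(1 - σ y) ^ (-μ)` as a formal power series in `y`. -/
def binomSeries (σ μ : ℝ) : ℝ⟦X⟧ := PowerSeries.mk fun n => (binomPoly n).eval μ * σ ^ n

/-- `C(σ y) ^ μ` as a formal power series in `y`, where `C` is the generating function of the
Catalan numbers. -/
def catSeries (σ μ : ℝ) : ℝ⟦X⟧ := PowerSeries.mk fun n => (catPoly n).eval μ * σ ^ n

lemma binomSeries_add (σ μ ν : ℝ) :
    binomSeries σ (μ + ν) = binomSeries σ μ * binomSeries σ ν := by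
  ext n
  simp only [binomSeries, PowerSeries.coeff_mul, PowerSeries.coeff_mk]
  rw [← sum_binomPoly, Finset.sum_mul]
  refine Finset.sum_congr rfl fun p hp => ?_
  rw [← HasAntidiagonal.mem_antidiagonal.mp hp, pow_add]
  ring

lemma catSeries_add (σ μ ν : ℝ) :
    catSeries σ (μ + ν) = catSeries σ μ * catSeries σ ν := by
  ext n
  simp only [catSeries, PowerSeries.coeff_mul, PowerSeries.coeff_mk]
  rw [← sum_catPoly, Finset.sum_mul]
  refine Finset.sum_congr rfl fun p hp => ?_
  rw [← HasAntidiagonal.mem_antidiagonal.mp hp, pow_add]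
  ring

lemma binomPoly_eval_nonneg {μ : ℝ} (hμ : 0 ≤ μ) (n : ℕ) : 0 ≤ (binomPoly n).eval μ := by
  rw [binomPoly_eval]
  exact div_nonneg (rising_nonneg hμ n) (by positivity)

lemma catPoly_eval_nonneg {μ : ℝ} (hμ : 0 ≤ μ) (n : ℕ) : 0 ≤ (catPoly n).eval μ := by
  rw [catPoly_eval hμ]
  have := rising_nonneg hμ (2 * n)
  have := rising_nonneg (show 0 ≤ μ + 1 by linarith) n
  positivity

/-- The logarithmic derivative of `(1 - σ y) ^ (-μ)` is `μ σ / (1 - σ y) = μ ∑ σⁿ⁺¹ yⁿ`. -/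
lemma derivative_binomSeries (σ μ : ℝ) :
    PowerSeries.derivative ℝ (binomSeries σ μ) =
      (PowerSeries.mk fun n => μ * σ ^ (n + 1)) * binomSeries σ μ := by
  have h : PowerSeries.derivative ℝ (binomSeries σ μ) = (μ * σ) • binomSeries σ (μ + 1) := by
    ext n
    simp only [PowerSeries.coeff_derivative, binomSeries, map_smul, PowerSeries.coeff_mk,
      binomPoly_eval, rising_succ_left μ, Nat.factorial_succ, smul_eq_mul]
    have : (n.factorial : ℝ) ≠ 0 := by positivity
    push_cast
    field_simp
    ring
  have h1 : binomSeries σ 1 = PowerSeries.mk fun n => σ ^ n := by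
    ext n
    have : (n.factorial : ℝ) ≠ 0 := by positivity
    simp [binomSeries, binomPoly_eval, rising, ascPochhammer_eval_one, this]
  have h2 : (PowerSeries.mk fun n => μ * σ ^ (n + 1)) =
      (μ * σ) • (PowerSeries.mk fun n => σ ^ n : ℝ⟦X⟧) := by
    ext n
    simp [pow_succ]; ring
  rw [h, h2, add_comm, binomSeries_add, h1, smul_mul_assoc]

lemma pow_add_pow_nonneg {σ τ : ℝ} (h : |τ| ≤ σ) (n : ℕ) : 0 ≤ σ ^ n + τ ^ n := by
  have h1 : |τ ^ n| ≤ σ ^ n := by rw [abs_pow]; gcongr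
  linarith [neg_abs_le (τ ^ n)]

lemma pow_le_pow_of_abs_le {σ τ : ℝ} (h : |τ| ≤ σ) (n : ℕ) : τ ^ n ≤ σ ^ n := by
  have h1 : |τ ^ n| ≤ σ ^ n := by rw [abs_pow]; gcongr
  linarith [le_abs_self (τ ^ n)]

/-- `((1 - σ y) (1 - τ y)) ^ (-μ)` has nonnegative coefficients when `|τ| ≤ σ`. -/
lemma coeffNonneg_binomSeries_mul {σ τ μ : ℝ} (h : |τ| ≤ σ) (hμ : 0 ≤ μ) :
    CoeffNonneg (binomSeries σ μ * binomSeries τ μ) := by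
  refine coeffNonneg_of_derivative_eq_mul
    (H := (PowerSeries.mk fun n => μ * σ ^ (n + 1)) + PowerSeries.mk fun n => μ * τ ^ (n + 1))
    (fun n => ?_) ?_ ?_
  · rw [map_add, PowerSeries.coeff_mk, PowerSeries.coeff_mk, ← mul_add]
    exact mul_nonneg hμ (pow_add_pow_nonneg h _)
  · simp [binomSeries, binomPoly]
  · rw [Derivation.leibniz, derivative_binomSeries, derivative_binomSeries, smul_eq_mul,
      smul_eq_mul]
    ring

lemma coeffNonneg_binomSeries_sub {σ τ μ : ℝ} (h : |τ| ≤ σ) (hμ : 0 ≤ μ) :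
    CoeffNonneg (binomSeries σ μ - binomSeries τ μ) := fun n => by
  simp only [binomSeries, map_sub, PowerSeries.coeff_mk, ← mul_sub]
  exact mul_nonneg (binomPoly_eval_nonneg hμ n) (sub_nonneg.2 (pow_le_pow_of_abs_le h n))

lemma coeffNonneg_catSeries {σ μ : ℝ} (h : 0 ≤ σ) (hμ : 0 ≤ μ) : CoeffNonneg (catSeries σ μ) :=
  fun n => by
    simp only [catSeries, PowerSeries.coeff_mk]
    exact mul_nonneg (catPoly_eval_nonneg hμ n) (pow_nonneg h n)

lemma coeffNonneg_catSeries_sub {σ τ μ : ℝ} (hτ : 0 ≤ τ) (h : τ ≤ σ) (hμ : 0 ≤ μ) :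
    CoeffNonneg (catSeries σ μ - catSeries τ μ) := fun n => by
  simp only [catSeries, map_sub, PowerSeries.coeff_mk, ← mul_sub]
  exact mul_nonneg (catPoly_eval_nonneg hμ n) (sub_nonneg.2 (by gcongr))

/-- Passing from `σ` to `-σ` is the substitution `y ↦ -y`. -/
lemma evalNegHom_binomSeries (σ μ : ℝ) :
    PowerSeries.evalNegHom (binomSeries σ μ) = binomSeries (-σ) μ := by
  ext n
  simp only [PowerSeries.evalNegHom, PowerSeries.coeff_rescale, binomSeries, PowerSeries.coeff_mk]
  rw [neg_pow σ]; ring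

lemma coeff_two_mul_evalNegHom (F : ℝ⟦X⟧) (n : ℕ) :
    PowerSeries.coeff (2 * n) (PowerSeries.evalNegHom F) = PowerSeries.coeff (2 * n) F := by
  simp [PowerSeries.evalNegHom, PowerSeries.coeff_rescale]

/-- The series `(φ ψ) ^ μ (φ ^ α - ψ ^ α) (φ ^ β - ψ ^ β)` for two exponential families
`φ ^ μ`, `ψ ^ μ`; Turánians of mixtures of exponential families are built from it. -/
def mixedTerm (φ ψ : ℝ → ℝ⟦X⟧) (μ α β : ℝ) : ℝ⟦X⟧ :=
  φ μ * ψ μ * ((φ α - ψ α) * (φ β - ψ β))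

lemma mixedTerm_comm (φ ψ : ℝ → ℝ⟦X⟧) (μ α β : ℝ) :
    mixedTerm φ ψ μ α β = mixedTerm ψ φ μ α β := by
  simp only [mixedTerm]; ring

lemma mixedTerm_binomSeries_coeff_nonneg (σ τ : ℝ) {μ α β : ℝ} (hμ : 0 ≤ μ) (hα : 0 ≤ α)
    (hβ : 0 ≤ β) (n : ℕ) :
    0 ≤ PowerSeries.coeff (2 * n) (mixedTerm (binomSeries σ) (binomSeries τ) μ α β) := by
  have main : ∀ σ τ : ℝ, |τ| ≤ σ →
      0 ≤ PowerSeries.coeff (2 * n) (mixedTerm (binomSeries σ) (binomSeries τ) μ α β) :=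
    fun σ τ h => (coeffNonneg_binomSeries_mul h hμ).mul
      ((coeffNonneg_binomSeries_sub h hα).mul (coeffNonneg_binomSeries_sub h hβ)) _
  have hneg : ∀ σ τ : ℝ,
      PowerSeries.coeff (2 * n) (mixedTerm (binomSeries (-σ)) (binomSeries (-τ)) μ α β) =
      PowerSeries.coeff (2 * n) (mixedTerm (binomSeries σ) (binomSeries τ) μ α β) := by
    intro σ τ
    rw [← coeff_two_mul_evalNegHom (mixedTerm (binomSeries σ) (binomSeries τ) μ α β)]
    simp only [mixedTerm, map_mul, map_sub, evalNegHom_binomSeries]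
  -- By the symmetries `σ ↔ τ` and `(σ, τ) ↦ (-σ, -τ)` one may assume `|τ| ≤ σ`.
  have half : ∀ σ τ : ℝ, |τ| ≤ |σ| →
      0 ≤ PowerSeries.coeff (2 * n) (mixedTerm (binomSeries σ) (binomSeries τ) μ α β) := by
    intro σ τ h
    rcases abs_cases σ with ⟨e, _⟩ | ⟨e, _⟩
    · exact main σ τ (e ▸ h)
    · rw [← hneg]
      exact main _ _ (by rw [abs_neg, ← e]; exact h)
  rcases le_total |τ| |σ| with h | h
  · exact half σ τ h
  · rw [mixedTerm_comm]; exact half τ σ h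

lemma mixedTerm_catSeries_coeffNonneg {σ τ : ℝ} (hσ : 0 ≤ σ) (hτ : 0 ≤ τ) {μ α β : ℝ}
    (hμ : 0 ≤ μ) (hα : 0 ≤ α) (hβ : 0 ≤ β) :
    CoeffNonneg (mixedTerm (catSeries σ) (catSeries τ) μ α β) := by
  have main : ∀ σ τ : ℝ, 0 ≤ τ → τ ≤ σ →
      CoeffNonneg (mixedTerm (catSeries σ) (catSeries τ) μ α β) :=
    fun σ τ h0 h => ((coeffNonneg_catSeries (h0.trans h) hμ).mul (coeffNonneg_catSeries h0 hμ)).mul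
      ((coeffNonneg_catSeries_sub h0 h hα).mul (coeffNonneg_catSeries_sub h0 h hβ))
  rcases le_total τ σ with h | h
  · exact main σ τ hτ h
  · rw [mixedTerm_comm]; exact main τ σ hσ h

/-- The Turánian of a finite mixture of exponential families. -/
lemma turanian_sum_smul {ι : Type*} [Fintype ι] (w : ι → ℝ) (φ : ι → ℝ → ℝ⟦X⟧)
    (hφ : ∀ i μ ν, φ i (μ + ν) = φ i μ * φ i ν) (μ α β : ℝ) :
    (2 : ℝ) • turanian (fun μ => ∑ i, w i • φ i μ) μ α β =
      -∑ i, ∑ j, (w i * w j) • mixedTerm (φ i) (φ j) μ α β := by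
  have h1 : turanian (fun μ => ∑ i, w i • φ i μ) μ α β =
      ∑ i, ∑ j, (w i * w j) • (φ i μ * φ j μ * (φ i α * φ j β - φ j α * φ j β)) := by
    simp only [turanian, Finset.sum_mul_sum, ← Finset.sum_sub_distrib, hφ]
    refine Finset.sum_congr rfl fun i _ => Finset.sum_congr rfl fun j _ => ?_
    simp only [smul_mul_smul_comm, ← smul_sub]
    congr 1
    ring
  rw [two_smul]
  nth_rewrite 2 [h1]
  rw [Finset.sum_comm, h1, ← Finset.sum_add_distrib, ← Finset.sum_neg_distrib]
  refine Finset.sum_congr rfl fun i _ => ?_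
  rw [← Finset.sum_add_distrib, ← Finset.sum_neg_distrib]
  refine Finset.sum_congr rfl fun j _ => ?_
  rw [mul_comm (w j) (w i), ← smul_add, ← smul_neg]
  congr 1
  simp only [mixedTerm]
  ring

/-! ### The closed cone of moment sequences -/

/-- The moment sequences `n ↦ ∑ wᵢ tᵢⁿ` of finitely supported positive measures on `[0, ∞)`. They
form a semiring: the product of two moment sequences belongs to the multiplicative convolution
of the measures. -/
def atomicMoments : Subsemiring (ℕ → ℝ) where
  carrier := {v | ∃ (ι : Type) (_ : Fintype ι) (w t : ι → ℝ), (∀ i, 0 ≤ w i) ∧ (∀ i, 0 ≤ t i) ∧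
    ∀ n, v n = ∑ i, w i * t i ^ n}
  mul_mem' := by
    rintro u v ⟨ι, _, w, t, hw, ht, h⟩ ⟨κ, _, w', t', hw', ht', h'⟩
    refine ⟨ι × κ, inferInstance, fun p => w p.1 * w' p.2, fun p => t p.1 * t' p.2,
      fun p => mul_nonneg (hw _) (hw' _), fun p => mul_nonneg (ht _) (ht' _), fun n => ?_⟩
    rw [Pi.mul_apply, h, h', Finset.sum_mul_sum, Fintype.sum_prod_type]
    refine Finset.sum_congr rfl fun i _ => Finset.sum_congr rfl fun j _ => ?_
    rw [mul_pow]; ring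
  one_mem' := ⟨Unit, inferInstance, fun _ => 1, fun _ => 1, by simp, by simp, by simp⟩
  add_mem' := by
    rintro u v ⟨ι, _, w, t, hw, ht, h⟩ ⟨κ, _, w', t', hw', ht', h'⟩
    exact ⟨ι ⊕ κ, inferInstance, Sum.elim w w', Sum.elim t t', by rintro (i | i) <;> simp [hw, hw'],
      by rintro (i | i) <;> simp [ht, ht'], fun n => by simp [h, h', Fintype.sum_sum_type]⟩
  zero_mem' := ⟨Empty, inferInstance, Empty.elim, Empty.elim, by simp, by simp, by simp⟩

/-- The closure, for pointwise convergence, of the moment sequences of finitely supported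
measures on `[0, ∞)`. -/
def momentCone : Subsemiring (ℕ → ℝ) := atomicMoments.topologicalClosure

lemma isClosed_momentCone : IsClosed (momentCone : Set (ℕ → ℝ)) :=
  atomicMoments.isClosed_topologicalClosure

lemma geometric_mem_momentCone {c t : ℝ} (hc : 0 ≤ c) (ht : 0 ≤ t) :
    (fun n => c * t ^ n) ∈ momentCone :=
  atomicMoments.le_topologicalClosure
    ⟨Unit, inferInstance, fun _ => c, fun _ => t, by simpa, by simpa, by simp⟩

/-- A closed condition on sequences holds on the moment cone once it holds for finitely supported
measures. -/
lemma momentCone_induction {p : (ℕ → ℝ) → Prop} (hp : IsClosed {v | p v})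
    (h : ∀ (ι : Type) [Fintype ι] (w t : ι → ℝ), (∀ i, 0 ≤ w i) → (∀ i, 0 ≤ t i) →
      p fun n => ∑ i, w i * t i ^ n) {v : ℕ → ℝ} (hv : v ∈ momentCone) : p v := by
  have : (momentCone : Set (ℕ → ℝ)) ⊆ {v | p v} := by
    refine closure_minimal ?_ hp
    rintro u ⟨ι, _, w, t, hw, ht, hu⟩
    obtain rfl : u = fun n => ∑ i, w i * t i ^ n := funext hu
    exact h ι w t hw ht
  exact this hv

/-- Moment sequences are log-convex, by the Cauchy–Schwarz inequality. -/
lemma sq_le_mul_of_mem_momentCone {v : ℕ → ℝ} (hv : v ∈ momentCone) (n : ℕ) :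
    v (n + 1) ^ 2 ≤ v n * v (n + 2) := by
  revert v
  refine fun {v} hv => momentCone_induction (p := fun v => v (n + 1) ^ 2 ≤ v n * v (n + 2)) ?_ ?_ hv
  · exact isClosed_le (by fun_prop) (by fun_prop)
  · intro ι _ w t hw ht
    exact Finset.sum_sq_le_sum_mul_sum_of_sq_le_mul _
      (fun i _ => mul_nonneg (hw i) (pow_nonneg (ht i) _))
      (fun i _ => mul_nonneg (hw i) (pow_nonneg (ht i) _)) fun i _ => le_of_eq (by ring)

/-! ### Log-convex families: mixtures of exponential families -/

/-- The family `μ ↦ ∑ vₙ cₙ(μ) xⁿ`. -/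
def weightedSeries (v : ℕ → ℝ) (c : ℕ → ℝ → ℝ) (μ : ℝ) : ℝ⟦X⟧ :=
  PowerSeries.mk fun n => v n * c n μ

lemma coeff_turanian_weightedSeries (v : ℕ → ℝ) (c : ℕ → ℝ → ℝ) (μ α β : ℝ) (k : ℕ) :
    PowerSeries.coeff k (turanian (weightedSeries v c) μ α β) =
      ∑ p ∈ antidiagonal k, v p.1 * v p.2 *
        (c p.1 (μ + α) * c p.2 (μ + β) - c p.1 μ * c p.2 (μ + α + β)) := by
  simp only [turanian, weightedSeries, map_sub, PowerSeries.coeff_mul, PowerSeries.coeff_mk]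
  rw [← Finset.sum_sub_distrib]
  exact Finset.sum_congr rfl fun p _ => by ring

lemma isClosed_coeff_turanian_nonpos (c : ℕ → ℝ → ℝ) (μ α β : ℝ) (k : ℕ) :
    IsClosed {v | PowerSeries.coeff k (turanian (weightedSeries v c) μ α β) ≤ 0} := by
  simp only [coeff_turanian_weightedSeries]
  exact isClosed_le (by fun_prop) continuous_const

/-- The Turánians only see the values of a family on `[0, ∞)`. -/
lemma turanian_congr {F G : ℝ → ℝ⟦X⟧} (h : ∀ μ, 0 ≤ μ → F μ = G μ) {μ α β : ℝ} (hμ : 0 ≤ μ)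
    (hα : 0 ≤ α) (hβ : 0 ≤ β) : turanian F μ α β = turanian G μ α β := by
  simp only [turanian]
  rw [h μ hμ, h (μ + α) (by positivity), h (μ + β) (by positivity),
    h (μ + α + β) (by positivity)]

lemma coeff_turanian_catSeries_nonpos {v : ℕ → ℝ} (hv : v ∈ momentCone) {μ α β : ℝ} (hμ : 0 ≤ μ)
    (hα : 0 ≤ α) (hβ : 0 ≤ β) (k : ℕ) :
    PowerSeries.coeff k
      (turanian (weightedSeries v fun n μ => (catPoly n).eval μ) μ α β) ≤ 0 := by
  refine momentCone_induction (isClosed_coeff_turanian_nonpos _ μ α β k) ?_ hv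
  intro ι _ w t hw ht
  have e : weightedSeries (fun n => ∑ i, w i * t i ^ n) (fun n μ => (catPoly n).eval μ) =
      fun μ => ∑ i, w i • catSeries (t i) μ := by
    funext μ
    ext n
    simp only [weightedSeries, catSeries, PowerSeries.coeff_mk, map_sum, map_smul, smul_eq_mul,
      Finset.sum_mul]
    exact Finset.sum_congr rfl fun i _ => by ring
  have h := congrArg (PowerSeries.coeff k)
    (turanian_sum_smul w (fun i => catSeries (t i)) (fun i => catSeries_add _) μ α β)
  rw [← e, map_smul, smul_eq_mul, map_neg] at h
  have h2 : 0 ≤ PowerSeries.coeff k (∑ i, ∑ j,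
      (w i * w j) • mixedTerm (catSeries (t i)) (catSeries (t j)) μ α β) := by
    simp only [map_sum, map_smul, smul_eq_mul]
    exact Finset.sum_nonneg fun i _ => Finset.sum_nonneg fun j _ =>
      mul_nonneg (mul_nonneg (hw i) (hw j))
        (mixedTerm_catSeries_coeffNonneg (ht i) (ht j) hμ hα hβ k)
  linarith

/-- The even part of `∑ wᵢ (1 - √tᵢ y) ^ (-μ)` is a mixture of the exponential families
`(1 ∓ √tᵢ y) ^ (-μ)`; here `x = y²`. -/
lemma coeff_turanian_binomSeries_nonpos {v : ℕ → ℝ} (hv : v ∈ momentCone) {μ α β : ℝ} (hμ : 0 ≤ μ)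
    (hα : 0 ≤ α) (hβ : 0 ≤ β) (k : ℕ) :
    PowerSeries.coeff k
      (turanian (weightedSeries v fun n μ => (binomPoly (2 * n)).eval μ) μ α β) ≤ 0 := by
  refine momentCone_induction (isClosed_coeff_turanian_nonpos _ μ α β k) ?_ hv
  intro ι _ w t hw ht
  let w' : ι ⊕ ι → ℝ := Sum.elim w w
  let s : ι ⊕ ι → ℝ := Sum.elim (fun i => √(t i)) fun i => -√(t i)
  have hw' : ∀ i, 0 ≤ w' i := by rintro (i | i) <;> exact hw i
  set G := weightedSeries (fun n => ∑ i, w i * t i ^ n) fun n μ => (binomPoly (2 * n)).eval μ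
    with hG
  have e : ∀ μ, ∑ i, w' i • binomSeries (s i) μ =
      (2 : ℝ) • PowerSeries.expand 2 two_ne_zero (G μ) := by
    intro μ
    ext n
    rw [Fintype.sum_sum_type, map_add, map_sum, map_sum]
    simp only [map_smul, smul_eq_mul, w', s, Sum.elim_inl, Sum.elim_inr, binomSeries,
      PowerSeries.coeff_mk]
    rcases Nat.even_or_odd' n with ⟨m, rfl | rfl⟩
    · rw [PowerSeries.coeff_expand_mul, hG, weightedSeries, PowerSeries.coeff_mk, Finset.sum_mul,
        Finset.mul_sum, ← Finset.sum_add_distrib]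
      refine Finset.sum_congr rfl fun i _ => ?_
      rw [pow_mul, pow_mul, neg_sq, Real.sq_sqrt (ht i)]
      ring
    · rw [PowerSeries.coeff_expand_of_not_dvd _ _ _ (by omega), ← Finset.sum_add_distrib]
      rw [mul_zero]
      refine Finset.sum_eq_zero fun i _ => ?_
      rw [(odd_two_mul_add_one m).neg_pow]
      ring
  have h := congrArg (PowerSeries.coeff (2 * k))
    (turanian_sum_smul w' (fun i => binomSeries (s i)) (fun i => binomSeries_add _) μ α β)
  have h1 : turanian (fun μ => ∑ i, w' i • binomSeries (s i) μ) μ α β =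
      (4 : ℝ) • PowerSeries.expand 2 two_ne_zero (turanian G μ α β) := by
    simp only [turanian, e, map_sub, map_mul, smul_sub, smul_mul_smul_comm]
    norm_num
  rw [h1, map_smul, map_smul, PowerSeries.coeff_expand_mul, smul_eq_mul, smul_eq_mul, map_neg] at h
  have h2 : 0 ≤ PowerSeries.coeff (2 * k) (∑ i, ∑ j,
      (w' i * w' j) • mixedTerm (binomSeries (s i)) (binomSeries (s j)) μ α β) := by
    simp only [map_sum, map_smul, smul_eq_mul]
    exact Finset.sum_nonneg fun i _ => Finset.sum_nonneg fun j _ =>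
      mul_nonneg (mul_nonneg (hw' i) (hw' j)) (mixedTerm_binomSeries_coeff_nonneg _ _ hμ hα hβ k)
  linarith

/-! ### Values of the series -/

lemma sumAt_mul_sumAt {F G : ℝ⟦X⟧} (hF : CoeffNonneg F) (hG : CoeffNonneg G) {x : ℝ} (hx : 0 ≤ x)
    (hFx : ConvergesAt F x) (hGx : ConvergesAt G x) :
    HasSum (fun n => PowerSeries.coeff n (F * G) * x ^ n) (sumAt F x * sumAt G x) := by
  have nn : ∀ {H : ℝ⟦X⟧}, CoeffNonneg H → ∀ n, 0 ≤ PowerSeries.coeff n H * x ^ n :=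
    fun hH n => mul_nonneg (hH n) (pow_nonneg hx n)
  have hFn : Summable fun n => ‖PowerSeries.coeff n F * x ^ n‖ := by
    simpa only [Real.norm_of_nonneg (nn hF _), ConvergesAt] using hFx
  have hGn : Summable fun n => ‖PowerSeries.coeff n G * x ^ n‖ := by
    simpa only [Real.norm_of_nonneg (nn hG _), ConvergesAt] using hGx
  have e : (fun n => PowerSeries.coeff n (F * G) * x ^ n) = fun n =>
      ∑ p ∈ antidiagonal n,
        (PowerSeries.coeff p.1 F * x ^ p.1) * (PowerSeries.coeff p.2 G * x ^ p.2) := by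
    funext n
    rw [PowerSeries.coeff_mul, Finset.sum_mul]
    refine Finset.sum_congr rfl fun p hp => ?_
    rw [← HasAntidiagonal.mem_antidiagonal.mp hp, pow_add]
    ring
  rw [e]
  have hs := (summable_norm_sum_mul_antidiagonal_of_summable_norm hFn hGn).of_norm
  rw [sumAt, sumAt, tsum_mul_tsum_eq_tsum_sum_antidiagonal_of_summable_norm hFn hGn]
  exact hs.hasSum

/-- For series with nonnegative coefficients, the value of the Turánian is the sum of its
coefficients' contributions. -/
lemma hasSum_turanian {F : ℝ → ℝ⟦X⟧} (hF : ∀ μ, 0 ≤ μ → CoeffNonneg (F μ)) {x μ α β : ℝ}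
    (hx : 0 ≤ x) (hμ : 0 ≤ μ) (hα : 0 ≤ α) (hβ : 0 ≤ β) (h0 : ConvergesAt (F μ) x)
    (h1 : ConvergesAt (F (μ + α)) x) (h2 : ConvergesAt (F (μ + β)) x)
    (h3 : ConvergesAt (F (μ + α + β)) x) :
    HasSum (fun n => PowerSeries.coeff n (turanian F μ α β) * x ^ n)
      (sumAt (F (μ + α)) x * sumAt (F (μ + β)) x - sumAt (F μ) x * sumAt (F (μ + α + β)) x) := by
  have a := sumAt_mul_sumAt (hF (μ + α) (by positivity)) (hF (μ + β) (by positivity)) hx h1 h2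
  have b := sumAt_mul_sumAt (hF μ hμ) (hF (μ + α + β) (by positivity)) hx h0 h3
  simpa only [turanian, map_sub, sub_mul] using a.sub b

/-! ### An integral representation of `log Γ` -/

section GammaIntegral

open MeasureTheory Set Filter Topology

lemma integrableOn_exp_neg_mul {c : ℝ} (hc : 0 < c) :
    IntegrableOn (fun u => Real.exp (-(c * u))) (Ioi 0) := by
  simpa only [neg_mul] using integrableOn_exp_mul_Ioi (neg_lt_zero.2 hc) 0

/-- The integrand of Frullani's integral for `exp (-u)` is bounded by `(q - p) exp (-p u)`. -/
lemma frullani_exp_bound {p q u : ℝ} (hu : 0 < u) :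
    |u⁻¹ * (Real.exp (-(p * u)) - Real.exp (-(q * u)))| ≤
      |q - p| * (Real.exp (-(p * u)) + Real.exp (-(q * u))) := by
  have key : ∀ p q : ℝ, p ≤ q →
      |Real.exp (-(p * u)) - Real.exp (-(q * u))| ≤ u * (|q - p| * Real.exp (-(p * u))) := by
    intro p q hpq
    have h1 : Real.exp (-(q * u)) ≤ Real.exp (-(p * u)) := by
      apply Real.exp_le_exp.2; nlinarith
    have h2 : Real.exp (-(q * u)) = Real.exp (-(p * u)) * Real.exp (-((q - p) * u)) := by
      rw [← Real.exp_add]; ring_nf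
    have h3 := Real.add_one_le_exp (-((q - p) * u))
    rw [abs_of_nonneg (sub_nonneg.2 h1), abs_of_nonneg (sub_nonneg.2 hpq), h2]
    nlinarith [Real.exp_pos (-(p * u))]
  have hp := Real.exp_pos (-(p * u))
  have hq := Real.exp_pos (-(q * u))
  have : |Real.exp (-(p * u)) - Real.exp (-(q * u))| ≤
      u * (|q - p| * (Real.exp (-(p * u)) + Real.exp (-(q * u)))) := by
    rcases le_total p q with h | h
    · refine (key p q h).trans ?_
      gcongr
      linarith
    · rw [abs_sub_comm, abs_sub_comm q p]
      refine (key q p h).trans ?_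
      gcongr
      linarith
  rw [abs_mul, abs_inv, abs_of_pos hu, inv_mul_le_iff₀ hu]
  exact this

lemma frullani_exp_integrableOn {p q : ℝ} (hp : 0 < p) (hq : 0 < q) :
    IntegrableOn (fun u => u⁻¹ * (Real.exp (-(p * u)) - Real.exp (-(q * u)))) (Ioi 0) := by
  have h := ((integrableOn_exp_neg_mul hp).add (integrableOn_exp_neg_mul hq)).const_mul |q - p|
  refine Integrable.mono' h (by fun_prop) ?_
  filter_upwards [ae_restrict_mem measurableSet_Ioi] with u hu
  exact frullani_exp_bound hu

lemma frullani_exp_integral {p q : ℝ} (hp : 0 < p) (hq : 0 < q) :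
    ∫ u in Ioi 0, u⁻¹ * (Real.exp (-(p * u)) - Real.exp (-(q * u))) = Real.log (q / p) := by
  have h := Frullani.integral_Ioi_eq (f := fun u : ℝ => Real.exp (-u)) (L := 1) (R := 0)
    ((Real.continuous_exp.comp continuous_neg).locallyIntegrable.locallyIntegrableOn _) hp hq
    ?_ ?_ (frullani_exp_integrableOn hp hq)
  · simpa using h
  · have : ContinuousAt (fun u : ℝ => Real.exp (-u)) 0 := by fun_prop
    simpa using this.tendsto.mono_left nhdsWithin_le_nhds
  · exact Real.tendsto_exp_neg_atTop_nhds_zero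

/-- The second-order kernel `e^{-nu} - 1 + n (1 - e^{-u})`. It vanishes for `n = 0, 1` and has
second difference `e^{-nu} (1 - e^{-u})²` in `n`. -/
def levyKernel (u : ℝ) (n : ℕ) : ℝ := Real.exp (-(n * u)) - 1 + n * (1 - Real.exp (-u))

lemma levyKernel_nonneg (u : ℝ) (n : ℕ) : 0 ≤ levyKernel u n := by
  have h := one_add_mul_le_pow (a := Real.exp (-u) - 1) (by linarith [Real.exp_pos (-u)]) n
  rw [add_sub_cancel, ← Real.exp_nat_mul, mul_neg] at h
  rw [levyKernel]
  linarith

lemma levyKernel_mul_exp (u c : ℝ) (n : ℕ) :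
    levyKernel u n * Real.exp (-(c * u)) / u =
      n * (u⁻¹ * (Real.exp (-(c * u)) - Real.exp (-((c + 1) * u)))) -
      u⁻¹ * (Real.exp (-(c * u)) - Real.exp (-((c + n) * u))) := by
  have e1 : Real.exp (-((c + 1) * u)) = Real.exp (-(c * u)) * Real.exp (-u) := by
    rw [← Real.exp_add]; ring_nf
  have e2 : Real.exp (-((c + n) * u)) = Real.exp (-(c * u)) * Real.exp (-(n * u)) := by
    rw [← Real.exp_add]; ring_nf
  rw [e1, e2, levyKernel]
  ring

lemma integrableOn_levyKernel_mul_exp {c : ℝ} (hc : 0 < c) (n : ℕ) :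
    IntegrableOn (fun u => levyKernel u n * Real.exp (-(c * u)) / u) (Ioi 0) := by
  simp only [levyKernel_mul_exp]
  exact ((frullani_exp_integrableOn hc (by positivity)).const_mul _).sub
    (frullani_exp_integrableOn hc (by positivity))

lemma integral_levyKernel_mul_exp {c : ℝ} (hc : 0 < c) (n : ℕ) :
    ∫ u in Ioi 0, levyKernel u n * Real.exp (-(c * u)) / u =
      n * Real.log ((c + 1) / c) - Real.log ((c + n) / c) := by
  simp only [levyKernel_mul_exp]
  rw [integral_sub ((frullani_exp_integrableOn hc (by positivity)).const_mul _)
    (frullani_exp_integrableOn hc (by positivity)), integral_const_mul,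
    frullani_exp_integral hc (by positivity), frullani_exp_integral hc (by positivity)]

/-- The function `e^{-au/A} / (1 - e^{-u/A}) = ∑ₖ e^{-(a+k)u/A}`. -/
def gammaKernel (A a u : ℝ) : ℝ := Real.exp (-a * u / A) / (1 - Real.exp (-u / A))

lemma exp_neg_div_lt_one {A u : ℝ} (hA : 0 < A) (hu : 0 < u) : Real.exp (-u / A) < 1 := by
  rw [Real.exp_lt_one_iff]
  exact div_neg_of_neg_of_pos (neg_lt_zero.2 hu) hA

lemma hasSum_gammaKernel {A u : ℝ} (hA : 0 < A) (hu : 0 < u) (a : ℝ) :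
    HasSum (fun k : ℕ => Real.exp (-((a + k) / A * u))) (gammaKernel A a u) := by
  have h1 := exp_neg_div_lt_one hA hu
  have h := (hasSum_geometric_of_lt_one (Real.exp_pos _).le h1).mul_left (Real.exp (-a * u / A))
  rw [gammaKernel, div_eq_mul_inv]
  refine h.congr_fun fun k => ?_
  rw [← Real.exp_nat_mul, ← Real.exp_add]
  congr 1
  field_simp
  ring

/-- The second-order part of `log Γ (A n + a)`. -/
def logGammaExcess (A a : ℝ) (n : ℕ) : ℝ :=
  Real.log (Real.Gamma (A * n + a)) - Real.log (Real.Gamma a) -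
    n * (Real.log (Real.Gamma (A + a)) - Real.log (Real.Gamma a))

/-- Euler's limit formula, in the form of a series for the second-order part of `log Γ`. -/
lemma hasSum_logGammaExcess {A a : ℝ} (hA : 0 < A) (ha : 0 < a) (n : ℕ) :
    HasSum (fun k : ℕ => ∫ u in Ioi 0, levyKernel u n * Real.exp (-((a + k) / A * u)) / u)
      (logGammaExcess A a n) := by
  have hnn : ∀ k : ℕ, 0 ≤ ∫ u in Ioi 0, levyKernel u n * Real.exp (-((a + k) / A * u)) / u :=
    fun k => setIntegral_nonneg measurableSet_Ioi fun u hu =>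
      div_nonneg (mul_nonneg (levyKernel_nonneg u n) (Real.exp_pos _).le) (le_of_lt hu)
  rw [hasSum_iff_tendsto_nat_of_nonneg hnn, ← tendsto_add_atTop_iff_nat 1]
  have t0 := Real.BohrMollerup.tendsto_log_gamma ha
  have t1 := Real.BohrMollerup.tendsto_log_gamma (show 0 < A + a by positivity)
  have tn := Real.BohrMollerup.tendsto_log_gamma (show 0 < A * n + a by positivity)
  have t := (tn.sub t0).sub ((t1.sub t0).const_mul (n : ℝ))
  refine t.congr fun m => ?_
  have e : ∀ k : ℕ, ∫ u in Ioi 0, levyKernel u n * Real.exp (-((a + k) / A * u)) / u =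
      n * (Real.log (A + a + k) - Real.log (a + k)) -
        (Real.log (A * n + a + k) - Real.log (a + k)) := by
    intro k
    have hk : 0 < a + k := by positivity
    rw [integral_levyKernel_mul_exp (by positivity)]
    have e1 : ((a + k) / A + 1) / ((a + k) / A) = (A + a + k) / (a + k) := by field_simp; ring
    have e2 : ((a + k) / A + n) / ((a + k) / A) = (A * n + a + k) / (a + k) := by
      field_simp; ring
    rw [e1, e2, Real.log_div (by positivity) hk.ne', Real.log_div (by positivity) hk.ne']
  simp only [e, Real.BohrMollerup.logGammaSeq, Finset.sum_sub_distrib, ← Finset.mul_sum]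
  ring

/-- `∫₀^∞ (e^{-nu} - 1 + n (1 - e^{-u})) e^{-au/A} / (1 - e^{-u/A}) du/u` converges and equals the
second-order part of `log Γ (A n + a)`. -/
lemma integral_levyKernel_mul_gammaKernel {A a : ℝ} (hA : 0 < A) (ha : 0 < a) (n : ℕ) :
    IntegrableOn (fun u => levyKernel u n * gammaKernel A a u / u) (Ioi 0) ∧
    ∫ u in Ioi 0, levyKernel u n * gammaKernel A a u / u = logGammaExcess A a n := by
  set F : ℕ → ℝ → ℝ := fun k u => levyKernel u n * Real.exp (-((a + k) / A * u)) / u with hF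
  have hsum := hasSum_logGammaExcess hA ha n
  have hint : ∀ k, Integrable (F k) (volume.restrict (Ioi 0)) := fun k =>
    integrableOn_levyKernel_mul_exp (by positivity) n
  have hnn : ∀ k, ∀ u ∈ Ioi (0 : ℝ), 0 ≤ F k u := fun k u hu =>
    div_nonneg (mul_nonneg (levyKernel_nonneg u n) (Real.exp_pos _).le) (le_of_lt hu)
  have hnorm : ∀ k, ∫ u in Ioi 0, ‖F k u‖ = ∫ u in Ioi 0, F k u := fun k =>
    setIntegral_congr_fun measurableSet_Ioi fun u hu => Real.norm_of_nonneg (hnn k u hu)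
  have hS : ∀ u ∈ Ioi (0 : ℝ), HasSum (fun k => F k u) (levyKernel u n * gammaKernel A a u / u) :=
    fun u hu => ((hasSum_gammaKernel hA hu a).mul_left (levyKernel u n)).div_const u
  have hsn : Summable fun k => ∫ u in Ioi 0, ‖F k u‖ := by
    simp only [hnorm]; exact hsum.summable
  constructor
  · refine ⟨?_, ?_⟩
    · refine Measurable.aestronglyMeasurable ?_
      unfold levyKernel gammaKernel
      fun_prop
    · have h1 : ∫⁻ u in Ioi 0, ‖levyKernel u n * gammaKernel A a u / u‖ₑ =
          ∑' k, ∫⁻ u in Ioi 0, ‖F k u‖ₑ := by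
        rw [← lintegral_tsum fun k => (hint k).1.enorm]
        refine setLIntegral_congr_fun measurableSet_Ioi fun u hu => ?_
        have hs := hS u hu
        rw [← hs.tsum_eq, Real.enorm_of_nonneg (tsum_nonneg fun k => hnn k u hu),
          ENNReal.ofReal_tsum_of_nonneg (fun k => hnn k u hu) hs.summable]
        exact tsum_congr fun k => (Real.enorm_of_nonneg (hnn k u hu)).symm
      have h2 : ∀ k, ∫⁻ u in Ioi 0, ‖F k u‖ₑ = ENNReal.ofReal (∫ u in Ioi 0, ‖F k u‖) := fun k =>
        (ofReal_integral_norm_eq_lintegral_enorm (hint k)).symm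
      rw [HasFiniteIntegral, h1]
      simp only [h2]
      rw [← ENNReal.ofReal_tsum_of_nonneg (fun k => integral_nonneg fun u => norm_nonneg _) hsn]
      exact ENNReal.ofReal_lt_top
  · have h := hasSum_integral_of_summable_integral_norm hint hsn
    rw [hsum.unique h]
    exact setIntegral_congr_fun measurableSet_Ioi fun u hu => (hS u hu).tsum_eq.symm

/-! ### Infinitely divisible moment sequences -/

/-- A closed convex cone of sequences contains the integrals of the integrable functions with
values in it. -/
lemma integral_mem_of_isClosed_cone {K : Set (ℕ → ℝ)} (hK : IsClosed K)
    (hadd : ∀ f ∈ K, ∀ g ∈ K, f + g ∈ K) (hsmul : ∀ c : ℝ, 0 ≤ c → ∀ f ∈ K, c • f ∈ K)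
    {f : ℝ → ℕ → ℝ} (hf : ∀ u, 0 < u → f u ∈ K)
    (hint : ∀ n, IntegrableOn (fun u => f u n) (Ioi 0)) :
    (fun n => ∫ u in Ioi 0, f u n) ∈ K := by
  -- The restriction to the first `N` terms brings the problem into a Banach space, and the
  -- density `e^{-u}` makes the measure a probability measure.
  have key : ∀ N : ℕ, (fun n : Fin N => ∫ u in Ioi 0, f u n) ∈
      closure ((fun (g : ℕ → ℝ) (n : Fin N) => g n) '' K) := by
    intro N
    set π : (ℕ → ℝ) → Fin N → ℝ := fun g n => g n with hπ
    let d : ℝ → NNReal := fun u => Real.toNNReal (Real.exp (-u))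
    have hd : Measurable d := by fun_prop
    have hd' : ∀ u, (d u : ℝ) = Real.exp (-u) := fun u => Real.coe_toNNReal _ (Real.exp_pos _).le
    let ν := (volume.restrict (Ioi (0 : ℝ))).withDensity fun u => (d u : ENNReal)
    have : IsProbabilityMeasure ν := by
      constructor
      rw [withDensity_apply _ MeasurableSet.univ, Measure.restrict_univ]
      change ∫⁻ u in Ioi 0, ENNReal.ofReal (Real.exp (-u)) = 1
      rw [← ofReal_integral_eq_lintegral_ofReal (integrableOn_exp_neg_Ioi 0)
        (Eventually.of_forall fun u => (Real.exp_pos _).le), integral_exp_neg_Ioi_zero,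
        ENNReal.ofReal_one]
    have hcomp : ∀ u, d u • (Real.exp u • π (f u)) = π (f u) := by
      intro u
      rw [NNReal.smul_def, hd', smul_smul, ← Real.exp_add]
      simp
    have hi : Integrable (fun u => π (f u)) (volume.restrict (Ioi 0)) :=
      Integrable.of_eval fun n => hint n
    have hiν : Integrable (fun u => Real.exp u • π (f u)) ν := by
      rw [integrable_withDensity_iff_integrable_smul hd]
      simpa only [hcomp] using hi
    have hconv : Convex ℝ (π '' K) := by
      rintro _ ⟨g, hg, rfl⟩ _ ⟨h, hh, rfl⟩ s t hs ht _
      exact ⟨s • g + t • h, hadd _ (hsmul s hs g hg) _ (hsmul t ht h hh), rfl⟩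
    have hmem : ∀ᵐ u ∂ν, Real.exp u • π (f u) ∈ closure (π '' K) := by
      refine (withDensity_absolutelyContinuous _ _).ae_le ?_
      filter_upwards [ae_restrict_mem measurableSet_Ioi] with u hu
      exact subset_closure ⟨Real.exp u • f u, hsmul _ (Real.exp_pos _).le _ (hf u hu), rfl⟩
    have h := hconv.closure.integral_mem isClosed_closure hmem hiν
    rw [integral_withDensity_eq_integral_smul hd] at h
    simp only [hcomp] at h
    convert h using 1
    funext n
    exact (eval_integral (f := fun u => π (f u)) (fun n : Fin N => hint n) n).symm
  have happrox : ∀ N : ℕ, ∃ g ∈ K, ∀ n < N, |(∫ u in Ioi 0, f u n) - g n| < 1 / ((N : ℝ) + 1) := by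
    intro N
    obtain ⟨_, ⟨g, hg, rfl⟩, hd⟩ := Metric.mem_closure_iff.1 (key N) (1 / ((N : ℝ) + 1))
      (by positivity)
    exact ⟨g, hg, fun n hn => ((dist_pi_lt_iff (by positivity)).1 hd ⟨n, hn⟩)⟩
  choose g hgK hg using happrox
  refine hK.mem_of_tendsto (f := g) (b := atTop) ?_ (Eventually.of_forall hgK)
  rw [tendsto_pi_nhds]
  intro n
  rw [tendsto_iff_dist_tendsto_zero]
  refine squeeze_zero' (Eventually.of_forall fun _ => dist_nonneg) ?_
    tendsto_one_div_add_atTop_nhds_zero_nat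
  filter_upwards [eventually_gt_atTop n] with N hN
  rw [dist_comm]
  exact (hg N n hN).le

lemma exp_mem_momentCone {v : ℕ → ℝ} (hv : v ∈ momentCone) :
    (fun n => Real.exp (v n)) ∈ momentCone := by
  refine isClosed_momentCone.mem_of_tendsto (b := atTop)
    (f := fun K : ℕ => ∑ k ∈ Finset.range K, (fun n => (1 / (k.factorial : ℝ)) * 1 ^ n) * v ^ k)
    ?_ (Eventually.of_forall fun K => ?_)
  · rw [tendsto_pi_nhds]
    intro n
    have h := (NormedSpace.expSeries_div_hasSum_exp (v n)).tendsto_sum_nat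
    rw [← congrFun Real.exp_eq_exp_ℝ (v n)] at h
    refine h.congr fun K => ?_
    rw [Finset.sum_apply]
    refine Finset.sum_congr rfl fun k _ => ?_
    simp [div_eq_inv_mul]
  · exact sum_mem fun k _ => mul_mem (geometric_mem_momentCone (by positivity) zero_le_one)
      (pow_mem hv k)

/-- The exponents of the infinitely divisible moment sequences. -/
def divisibleExponents : Set (ℕ → ℝ) :=
  {φ | ∀ s : ℝ, 0 ≤ s → (fun n => Real.exp (s * φ n)) ∈ momentCone}

lemma isClosed_divisibleExponents : IsClosed divisibleExponents := by
  have : divisibleExponents = ⋂ s : ℝ, ⋂ (_ : 0 ≤ s),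
      (fun φ : ℕ → ℝ => fun n => Real.exp (s * φ n)) ⁻¹' (momentCone : Set (ℕ → ℝ)) := by
    ext φ; simp [divisibleExponents]
  rw [this]
  refine isClosed_iInter fun s => isClosed_iInter fun _ => isClosed_momentCone.preimage ?_
  fun_prop

/-- The Lévy–Khinchine building block: `exp (s (tⁿ - 1 + n (1 - t)))` with `t = e^{-u}` is, up to a
constant and a geometric factor, the exponential `exp (s tⁿ)` of a moment sequence. -/
lemma levyKernel_mem_divisibleExponents (u : ℝ) : levyKernel u ∈ divisibleExponents := by
  intro s hs
  have h1 := geometric_mem_momentCone (Real.exp_pos (-s)).le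
    (Real.exp_pos (s * (1 - Real.exp (-u)))).le
  have h2 := exp_mem_momentCone (geometric_mem_momentCone hs (Real.exp_pos (-u)).le)
  have h := mul_mem h1 h2
  convert h using 1
  funext n
  rw [Pi.mul_apply, ← Real.exp_nat_mul, ← Real.exp_nat_mul, ← Real.exp_add, ← Real.exp_add,
    levyKernel]
  congr 1
  ring_nf

lemma kernelNonneg_iff {p q : ℕ} (A a : Fin p → ℝ) (B b : Fin q → ℝ) :
    KernelNonneg A a B b ↔ ∀ u : ℝ, 0 < u →
      0 ≤ ∑ i, gammaKernel (A i) (a i) u - ∑ j, gammaKernel (B j) (b j) u := Iff.rfl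

/-- If the kernel `P` is nonnegative, then `V` lies in the moment cone: its logarithm is an affine
function of `n` plus `∫₀^∞ (e^{-nu} - 1 + n (1 - e^{-u})) P(u) du/u`. -/
theorem V_mem_momentCone {p q : ℕ} {A a : Fin p → ℝ} {B b : Fin q → ℝ} {θ : ℝ}
    (hA : ∀ i, 0 < A i) (ha : ∀ i, 0 < a i) (hB : ∀ j, 0 < B j) (hb : ∀ j, 0 < b j)
    (hθ : 0 < θ) (hP : KernelNonneg A a B b) : V A a B b θ ∈ momentCone := by
  set P : ℝ → ℝ := fun u => ∑ i, gammaKernel (A i) (a i) u - ∑ j, gammaKernel (B j) (b j) u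
  set Φ : ℕ → ℝ := fun n =>
    ∑ i, logGammaExcess (A i) (a i) n - ∑ j, logGammaExcess (B j) (b j) n
  have hexp : ∀ u n, ((P u / u) • levyKernel u) n =
      ∑ i, levyKernel u n * gammaKernel (A i) (a i) u / u -
      ∑ j, levyKernel u n * gammaKernel (B j) (b j) u / u := by
    intro u n
    rw [← Finset.sum_div, ← Finset.sum_div, ← Finset.mul_sum, ← Finset.mul_sum, Pi.smul_apply,
      smul_eq_mul]
    ring
  have hiA : ∀ n i, Integrable (fun u => levyKernel u n * gammaKernel (A i) (a i) u / u)
      (volume.restrict (Ioi 0)) := fun n i =>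
    (integral_levyKernel_mul_gammaKernel (hA i) (ha i) n).1
  have hiB : ∀ n j, Integrable (fun u => levyKernel u n * gammaKernel (B j) (b j) u / u)
      (volume.restrict (Ioi 0)) := fun n j =>
    (integral_levyKernel_mul_gammaKernel (hB j) (hb j) n).1
  have hΦ : Φ ∈ divisibleExponents := by
    have h := integral_mem_of_isClosed_cone isClosed_divisibleExponents
      (f := fun u => (P u / u) • levyKernel u) ?_ ?_ ?_ ?_
    · convert h using 1
      funext n
      simp only [hexp]
      rw [integral_sub (integrable_finsetSum _ fun i _ => hiA n i)
        (integrable_finsetSum _ fun j _ => hiB n j),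
        integral_finsetSum _ fun i _ => hiA n i, integral_finsetSum _ fun j _ => hiB n j]
      simp only [(integral_levyKernel_mul_gammaKernel (hA _) (ha _) n).2,
        (integral_levyKernel_mul_gammaKernel (hB _) (hb _) n).2, Φ]
    · intro f hf g hg s hs
      convert mul_mem (hf s hs) (hg s hs) using 1
      funext n
      rw [Pi.mul_apply, ← Real.exp_add, Pi.add_apply, mul_add]
    · intro c hc f hf s hs
      convert hf (s * c) (mul_nonneg hs hc) using 1
      funext n
      rw [Pi.smul_apply, smul_eq_mul, mul_assoc]
    · intro u hu s hs
      convert levyKernel_mem_divisibleExponents u (s * (P u / u))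
        (mul_nonneg hs (div_nonneg (hP u hu) hu.le)) using 1
      funext n
      rw [Pi.smul_apply, smul_eq_mul, mul_assoc]
    · intro n
      simp only [hexp]
      exact (integrable_finsetSum _ fun i _ => hiA n i).sub
        (integrable_finsetSum _ fun j _ => hiB n j)
  set L₀ := ∑ i, Real.log (Real.Gamma (a i)) - ∑ j, Real.log (Real.Gamma (b j))
  set L₁ := ∑ i, (Real.log (Real.Gamma (A i + a i)) - Real.log (Real.Gamma (a i))) -
    ∑ j, (Real.log (Real.Gamma (B j + b j)) - Real.log (Real.Gamma (b j))) - Real.log θ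
  have hgeo := geometric_mem_momentCone (Real.exp_pos L₀).le (Real.exp_pos L₁).le
  have hΦ1 := hΦ 1 zero_le_one
  convert mul_mem hgeo hΦ1 using 1
  funext n
  have hprod : ∀ {r : ℕ} (C c : Fin r → ℝ), (∀ i, 0 < C i) → (∀ i, 0 < c i) →
      gammaProd C c n = Real.exp (∑ i, Real.log (Real.Gamma (C i * n + c i))) := by
    intro r C c hC hc
    rw [Real.exp_sum, gammaProd]
    refine Finset.prod_congr rfl fun i _ => (Real.exp_log (Real.Gamma_pos_of_pos ?_)).symm
    have := hC i
    have := hc i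
    positivity
  rw [V, hprod A a hA ha, hprod B b hB hb, Pi.mul_apply, one_mul, ← Real.exp_nat_mul,
    ← Real.exp_add, ← Real.exp_add]
  nth_rewrite 1 [← Real.exp_log hθ]
  rw [← Real.exp_nat_mul, ← Real.exp_add, ← Real.exp_sub]
  congr 1
  simp only [Φ, L₀, L₁, logGammaExcess, Finset.sum_sub_distrib, ← Finset.mul_sum]
  ring

end GammaIntegral

/-! ### Parameters with nonnegative kernel -/

lemma le_gammaKernel {A a u : ℝ} (hA : 0 < A) (hu : 0 < u) :
    A / u * Real.exp (-a * u / A) ≤ gammaKernel A a u := by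
  have h1 := exp_neg_div_lt_one hA hu
  have h2 := Real.add_one_le_exp (-u / A)
  have h3 : 1 - Real.exp (-u / A) ≤ u / A := by
    have : -u / A = -(u / A) := by ring
    linarith
  rw [gammaKernel, le_div_iff₀ (by linarith)]
  have he := Real.exp_pos (-a * u / A)
  calc A / u * Real.exp (-a * u / A) * (1 - Real.exp (-u / A))
      ≤ A / u * Real.exp (-a * u / A) * (u / A) := by gcongr
    _ = Real.exp (-a * u / A) := by field_simp

lemma gammaKernel_le {B b u : ℝ} (hB : 0 < B) (hu : 0 < u) :
    gammaKernel B b u ≤ B / u * Real.exp (-((b - 1) / B) * u) := by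
  have h1 := exp_neg_div_lt_one hB hu
  have h2 := Real.add_one_le_exp (u / B)
  have e1 : Real.exp (-b * u / B) = Real.exp (-((b - 1) / B) * u) * Real.exp (-u / B) := by
    rw [← Real.exp_add]; congr 1; field_simp; ring
  have e2 : Real.exp (u / B) * Real.exp (-u / B) = 1 := by
    rw [← Real.exp_add, ← Real.exp_zero]; congr 1; ring
  rw [gammaKernel, div_le_iff₀ (by linarith), e1]
  have h3 : Real.exp (-u / B) ≤ B / u * (1 - Real.exp (-u / B)) := by
    rw [div_mul_eq_mul_div, le_div_iff₀ hu]
    have hp := Real.exp_pos (-u / B)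
    have h4 : (u / B + 1) * Real.exp (-u / B) ≤ 1 := by
      refine (mul_le_mul_of_nonneg_right h2 hp.le).trans e2.le
    have h5 : B * ((u / B + 1) * Real.exp (-u / B)) ≤ B * 1 := by gcongr
    have h6 : B * ((u / B + 1) * Real.exp (-u / B)) = (u + B) * Real.exp (-u / B) := by
      field_simp
    linarith
  calc Real.exp (-((b - 1) / B) * u) * Real.exp (-u / B)
      ≤ Real.exp (-((b - 1) / B) * u) * (B / u * (1 - Real.exp (-u / B))) := by gcongr
    _ = _ := by ring

/-- With weights `ω`, Jensen's inequality gives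
`e^{-(bⱼ-1)u/Bⱼ} ≤ ∑ ωᵢ e^{-aᵢu/Aᵢ}`; the remaining factors are compared with `Bⱼ/u` and `Aᵢ/u`. -/
lemma kernelNonneg_of_weightCondition {p q : ℕ} {A a : Fin p → ℝ} {B b : Fin q → ℝ}
    (hA : ∀ i, 0 < A i) (hB : ∀ j, 0 < B j) (h : WeightCondition A a B b) :
    KernelNonneg A a B b := by
  obtain ⟨ω, hω, hω1, hωA, hωb⟩ := h
  rw [kernelNonneg_iff]
  intro u hu
  rw [sub_nonneg]
  have hJ : ∀ j, Real.exp (-((b j - 1) / B j) * u) ≤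
      ∑ i, ω i * Real.exp (-a i * u / A i) := by
    intro j
    have h1 := convexOn_exp.map_sum_le (t := Finset.univ) (w := ω)
      (p := fun i => -a i * u / A i) (fun i _ => hω i) hω1 (fun i _ => Set.mem_univ _)
    simp only [smul_eq_mul] at h1
    refine le_trans (Real.exp_le_exp.2 ?_) h1
    have h2 : ∑ i, ω i * (-a i * u / A i) = -(∑ i, ω i * a i / A i) * u := by
      rw [← Finset.sum_neg_distrib, Finset.sum_mul]
      exact Finset.sum_congr rfl fun i _ => by ring
    rw [h2]
    have := hωb j
    gcongr
  calc ∑ j, gammaKernel (B j) (b j) u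
      ≤ ∑ j, B j / u * ∑ i, ω i * Real.exp (-a i * u / A i) := by
        refine Finset.sum_le_sum fun j _ => (gammaKernel_le (hB j) hu).trans ?_
        have := hB j
        gcongr
        exact hJ j
    _ = ∑ i, (ω i * ∑ j, B j) / u * Real.exp (-a i * u / A i) := by
        rw [← Finset.sum_mul, ← Finset.sum_div, Finset.mul_sum]
        exact Finset.sum_congr rfl fun i _ => by ring
    _ ≤ ∑ i, gammaKernel (A i) (a i) u := by
        refine Finset.sum_le_sum fun i _ => le_trans ?_ (le_gammaKernel (hA i) hu)
        have := hωA i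
        gcongr

/-- The weights `ωᵢ = Aᵢ / ∑ A` turn the second condition on the parameters into the third. -/
lemma kernelNonneg_of_sumCondition {p q : ℕ} {A a : Fin p → ℝ} {B b : Fin q → ℝ}
    (hA : ∀ i, 0 < A i) (hB : ∀ j, 0 < B j) (hsum : ∑ j, B j = ∑ i, A i)
    (h : SumCondition a B b) : KernelNonneg A a B b := by
  rcases Nat.eq_zero_or_pos p with rfl | hp
  · have hq : q = 0 := by
      by_contra hq
      have : Nonempty (Fin q) := ⟨⟨0, Nat.pos_of_ne_zero hq⟩⟩
      have := Finset.sum_pos (fun j _ => hB j) Finset.univ_nonempty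
      simp [hsum] at this
    subst hq
    intro u _
    simp
  · have : Nonempty (Fin p) := ⟨⟨0, hp⟩⟩
    have hS : 0 < ∑ i, A i := Finset.sum_pos (fun i _ => hA i) Finset.univ_nonempty
    refine kernelNonneg_of_weightCondition hA hB ⟨fun i => A i / ∑ i, A i,
      fun i => div_nonneg (hA i).le hS.le, ?_, fun i => ?_, fun j => ?_⟩
    · rw [← Finset.sum_div, div_self hS.ne']
    · rw [hsum, div_mul_cancel₀ _ hS.ne']
    · obtain ⟨h1, h2⟩ := h j
      have h3 : ∑ i, A i / (∑ i, A i) * a i / A i = (∑ i, a i) / ∑ i, A i := by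
        rw [Finset.sum_div]
        refine Finset.sum_congr rfl fun i _ => ?_
        have := (hA i).ne'
        field_simp
      rw [h3, div_le_div_iff₀ hS (hB j)]
      rw [hsum, div_mul_eq_mul_div, div_le_iff₀ (by linarith)] at h2
      linarith

/-- Summation by parts: an antitone nonnegative weight preserves nonnegativity of all partial
sums. -/
lemma last_mul_sum_le {r : ℕ} (s δ : Fin (r + 1) → ℝ) (hs : Antitone s)
    (hδ : ∀ k, 0 ≤ ∑ j ∈ Finset.Iic k, δ j) : s (Fin.last r) * ∑ j, δ j ≤ ∑ j, s j * δ j := by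
  induction r with
  | zero => simp
  | succ r ih =>
    have hI : ∀ k : Fin (r + 1), ∑ j ∈ Finset.Iic k.castSucc, δ j =
        ∑ j ∈ Finset.Iic k, δ j.castSucc := by
      intro k
      rw [← Fin.map_castSuccEmb_Iic, Finset.sum_map]
      rfl
    have h := ih (fun j => s j.castSucc) (fun j => δ j.castSucc)
      (fun i j hij => hs (Fin.castSucc_le_castSucc_iff.2 hij)) fun k => hI k ▸ hδ k.castSucc
    have h0 : 0 ≤ ∑ j : Fin (r + 1), δ j.castSucc := by
      have := hδ (Fin.last r).castSucc
      rw [hI] at this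
      have e : Finset.Iic (Fin.last r) = Finset.univ := by
        ext k; simp [Fin.le_last]
      rwa [e] at this
    have hle : s (Fin.last (r + 1)) ≤ s (Fin.last r).castSucc := hs (Fin.le_last _)
    rw [Fin.sum_univ_castSucc δ, Fin.sum_univ_castSucc fun j => s j * δ j, mul_add]
    have := mul_le_mul_of_nonneg_right hle h0
    linarith

/-- Weak majorization: for a decreasing convex sequence `ψ` on the positive integers,
`∑ ψ(βⱼ) ≤ ∑ ψ(αⱼ)` when the partial sums of the increasing sequence `β` dominate those of `α`. -/
lemma sum_le_sum_of_majorized {r : ℕ} {α β : Fin r → ℕ} (hβ : Monotone β) (hα1 : ∀ j, 0 < α j)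
    (hβ1 : ∀ j, 0 < β j) (hαβ : ∀ k, ∑ j ∈ Finset.Iic k, α j ≤ ∑ j ∈ Finset.Iic k, β j)
    {ψ : ℕ → ℝ} (hanti : ∀ n, 0 < n → ψ (n + 1) ≤ ψ n)
    (hconv : ∀ n, 0 < n → ψ (n + 1) - ψ (n + 2) ≤ ψ n - ψ (n + 1)) :
    ∑ j, ψ (β j) ≤ ∑ j, ψ (α j) := by
  have hd : ∀ m n, 0 < m → m ≤ n → ψ n - ψ (n + 1) ≤ ψ m - ψ (m + 1) := by
    intro m n hm hmn
    induction n, hmn using Nat.le_induction with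
    | base => exact le_rfl
    | succ n hn ih => exact (hconv n (hm.trans_le hn)).trans ih
  -- the supporting line of `ψ` at `b`
  have htan : ∀ a b : ℕ, 0 < a → 0 < b →
      ψ b + (ψ b - ψ (b + 1)) * ((b : ℝ) - a) ≤ ψ a := by
    intro a b ha hb
    rcases le_total a b with h | h
    · induction b, h using Nat.le_induction with
      | base => simp
      | succ b hab ih =>
        have h1 := ih (ha.trans_le hab)
        have h2 := hconv b (ha.trans_le hab)
        have h3 : (a : ℝ) ≤ b := by exact_mod_cast hab
        push_cast
        nlinarith
    · induction a, h using Nat.le_induction with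
      | base => simp
      | succ a hab ih =>
        have h1 := ih (hb.trans_le hab)
        have h2 := hd b a hb hab
        push_cast
        linarith
  cases r with
  | zero => simp
  | succ r =>
    have h := last_mul_sum_le (fun j => ψ (β j) - ψ (β j + 1)) (fun j => (β j : ℝ) - α j)
      (fun i j hij => hd _ _ (hβ1 i) (hβ hij)) fun k => by
        rw [Finset.sum_sub_distrib, sub_nonneg]
        exact_mod_cast hαβ k
    have h0 : 0 ≤ ∑ j, ((β j : ℝ) - α j) := by
      have e : Finset.Iic (Fin.last r) = Finset.univ := by
        ext k; simp [Fin.le_last]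
      have := hαβ (Fin.last r)
      rw [e] at this
      rw [Finset.sum_sub_distrib, sub_nonneg]
      exact_mod_cast this
    have h1 : 0 ≤ ψ (β (Fin.last r)) - ψ (β (Fin.last r) + 1) :=
      sub_nonneg.2 (hanti _ (hβ1 _))
    have h2 : ∑ j, (ψ (β j) + (ψ (β j) - ψ (β j + 1)) * ((β j : ℝ) - α j)) ≤ ∑ j, ψ (α j) :=
      Finset.sum_le_sum fun j _ => htan _ _ (hα1 j) (hβ1 j)
    rw [Finset.sum_add_distrib] at h2
    have := mul_nonneg h1 h0
    linarith

/-- `y / (e^y - 1)`, the generating function of the Bernoulli numbers. -/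
def bernoulliFun (y : ℝ) : ℝ := y / (Real.exp y - 1)

lemma exp_sub_one_pos {y : ℝ} (hy : 0 < y) : 0 < Real.exp y - 1 := by
  have := Real.add_one_lt_exp hy.ne'
  linarith

lemma hasDerivAt_bernoulliFun {y : ℝ} (hy : 0 < y) :
    HasDerivAt bernoulliFun ((Real.exp y - 1 - y * Real.exp y) / (Real.exp y - 1) ^ 2) y := by
  have h := (hasDerivAt_id y).div ((Real.hasDerivAt_exp y).sub_const 1) (exp_sub_one_pos hy).ne'
  refine (h.congr_deriv ?_).congr_of_eventuallyEq (Filter.Eventually.of_forall fun _ => rfl)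
  simp

lemma bernoulliFun_antitoneOn : AntitoneOn bernoulliFun (Set.Ioi 0) := by
  refine antitoneOn_of_deriv_nonpos (convex_Ioi 0)
    (fun y hy => (hasDerivAt_bernoulliFun hy).continuousAt.continuousWithinAt)
    (fun y hy =>
      (hasDerivAt_bernoulliFun (interior_subset hy)).differentiableAt.differentiableWithinAt)
    fun y hy => ?_
  rw [(hasDerivAt_bernoulliFun (interior_subset hy)).deriv]
  refine div_nonpos_of_nonpos_of_nonneg ?_ (sq_nonneg _)
  have h1 := Real.add_one_le_exp (-y)
  have h2 : Real.exp y * Real.exp (-y) = 1 := by rw [← Real.exp_add]; simp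
  nlinarith [Real.exp_pos y]

/-- The numerator of the second derivative of `y / (e^y - 1)`. -/
lemma sub_two_mul_exp_add_nonneg {y : ℝ} (hy : 0 ≤ y) : 0 ≤ (y - 2) * Real.exp y + y + 2 := by
  have hmono : MonotoneOn (fun y : ℝ => (y - 2) * Real.exp y + y + 2) (Set.Ici 0) := by
    have hd : ∀ y : ℝ, HasDerivAt (fun y : ℝ => (y - 2) * Real.exp y + y + 2)
        (1 * Real.exp y + (y - 2) * Real.exp y + 1) y := fun y =>
      ((((hasDerivAt_id y).sub_const 2).mul (Real.hasDerivAt_exp y)).add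
        (hasDerivAt_id y)).add_const 2
    refine monotoneOn_of_deriv_nonneg (convex_Ici 0) (by fun_prop)
      (fun y _ => (hd y).differentiableAt.differentiableWithinAt) fun y _ => ?_
    rw [(hd y).deriv]
    have h1 := Real.add_one_le_exp (-y)
    have h2 : Real.exp y * Real.exp (-y) = 1 := by rw [← Real.exp_add]; simp
    nlinarith [Real.exp_pos y]
  have := hmono (Set.mem_Ici.2 le_rfl) (Set.mem_Ici.2 hy) hy
  simpa using this

lemma bernoulliFun_convexOn : ConvexOn ℝ (Set.Ioi 0) bernoulliFun := by
  refine convexOn_of_hasDerivWithinAt2_nonneg (convex_Ioi 0)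
    (f' := fun y => (Real.exp y - 1 - y * Real.exp y) / (Real.exp y - 1) ^ 2)
    (f'' := fun y => Real.exp y * ((y - 2) * Real.exp y + y + 2) / (Real.exp y - 1) ^ 3)
    (fun y hy => (hasDerivAt_bernoulliFun hy).continuousAt.continuousWithinAt)
    (fun y hy => (hasDerivAt_bernoulliFun (interior_subset hy)).hasDerivWithinAt)
    (fun y hy => ?_) fun y hy => ?_
  · have hy' : 0 < y := interior_subset hy
    have hp := exp_sub_one_pos hy'
    have h1 := ((Real.hasDerivAt_exp y).sub_const 1).sub
      ((hasDerivAt_id y).mul (Real.hasDerivAt_exp y))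
    have h2 := ((Real.hasDerivAt_exp y).sub_const 1).pow 2
    have h := h1.div h2 (pow_ne_zero 2 hp.ne')
    refine (h.congr_deriv ?_).hasDerivWithinAt
    simp only [id, Pi.pow_apply, Pi.sub_apply, Pi.mul_apply]
    field_simp
    ring
  · have hy' : 0 < y := interior_subset hy
    have hp := exp_sub_one_pos hy'
    have := sub_two_mul_exp_add_nonneg hy'.le
    positivity

/-- `y e^{-dy} / (e^y - 1)` is decreasing and convex on `(0, ∞)` for `d ≥ 0`. -/
lemma exp_mul_bernoulliFun {d : ℝ} (hd : 0 ≤ d) :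
    AntitoneOn (fun y => Real.exp (-(d * y)) * bernoulliFun y) (Set.Ioi 0) ∧
    ConvexOn ℝ (Set.Ioi 0) fun y => Real.exp (-(d * y)) * bernoulliFun y := by
  have hpos : ∀ ⦃y : ℝ⦄, y ∈ Set.Ioi (0 : ℝ) → 0 ≤ bernoulliFun y := fun y hy =>
    div_nonneg (le_of_lt hy) (exp_sub_one_pos hy).le
  have hanti : AntitoneOn (fun y : ℝ => Real.exp (-(d * y))) (Set.Ioi 0) := by
    intro x _ y _ hxy
    apply Real.exp_le_exp.2
    have := mul_le_mul_of_nonneg_left hxy hd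
    linarith
  constructor
  · intro x hx y hy hxy
    exact mul_le_mul (hanti hx hy hxy) (bernoulliFun_antitoneOn hx hy hxy) (hpos hy)
      (Real.exp_pos _).le
  · have hconv : ConvexOn ℝ (Set.Ioi 0) fun y : ℝ => Real.exp (-(d * y)) := by
      have h := (convexOn_exp.comp_linearMap ((-d) • LinearMap.id (R := ℝ) (M := ℝ))).subset
        (Set.subset_univ _) (convex_Ioi 0)
      refine h.congr fun y _ => ?_
      simp
    exact hconv.mul bernoulliFun_convexOn (fun y _ => (Real.exp_pos _).le) hpos
      (hanti.monovaryOn bernoulliFun_antitoneOn)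

lemma mul_gammaKernel_one_div {c u : ℝ} (hu : 0 < u) {n : ℕ} (hn : 0 < n) :
    (n : ℝ) * gammaKernel (1 / n) c u =
      u⁻¹ * (Real.exp (-((c - 1) * (u * n))) * bernoulliFun (u * n)) := by
  have hn' : (0 : ℝ) < n := by exact_mod_cast hn
  have hp := exp_sub_one_pos (show 0 < u * n by positivity)
  have e1 : Real.exp (-c * u / (1 / n)) =
      Real.exp (-((c - 1) * (u * n))) * Real.exp (-(u * n)) := by
    rw [← Real.exp_add]; congr 1; field_simp; ring
  have e2 : 1 - Real.exp (-u / (1 / n)) = Real.exp (-(u * n)) * (Real.exp (u * n) - 1) := by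
    rw [mul_sub, ← Real.exp_add, neg_add_cancel, Real.exp_zero, mul_one, div_div_eq_mul_div,
      div_one, neg_mul]
  have := Real.exp_pos (-(u * n))
  rw [gammaKernel, bernoulliFun, e1, e2]
  field_simp

/-- In the block case the kernel is `∑ ψ(αⱼ) - ∑ ψ(βⱼ)` with `ψ(y) = y e^{-cyu} / (1 - e^{-yu})`
decreasing and convex. -/
lemma kernelNonneg_of_blockCondition {p q : ℕ} {A a : Fin p → ℝ} {B b : Fin q → ℝ} {θ : ℝ}
    (h : BlockCondition A a B b θ) : KernelNonneg A a B b := by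
  obtain ⟨r, α, β, c, e₁, e₂, hα, hβ, -, hβm, hαβ, hc, ha, hb, hA, hB, -⟩ := h
  rw [kernelNonneg_iff]
  intro u hu
  have hsum : ∀ {p : ℕ} (γ : Fin r → ℕ) (e : (Σ j, Fin (γ j)) ≃ Fin p) (C d : Fin p → ℝ),
      (∀ i, d i = c) → (∀ s, C (e s) = 1 / (γ s.1 : ℝ)) →
      ∑ i, gammaKernel (C i) (d i) u = ∑ j, (γ j : ℝ) * gammaKernel (1 / γ j) c u := by
    intro p γ e C d hd hC
    rw [← e.sum_comp, Fintype.sum_sigma]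
    simp only [hd, hC, Finset.sum_const, Finset.card_univ, Fintype.card_fin, nsmul_eq_mul]
  rw [hsum α e₁ A a ha hA, hsum β e₂ B b hb hB, sub_nonneg]
  obtain ⟨hanti, hconv⟩ := exp_mul_bernoulliFun (sub_nonneg.2 hc)
  refine sum_le_sum_of_majorized (ψ := fun n => (n : ℝ) * gammaKernel (1 / n) c u) hβm hα hβ hαβ
    (fun n hn => ?_) fun n hn => ?_
  · have hn' : (0 : ℝ) < n := by exact_mod_cast hn
    rw [mul_gammaKernel_one_div hu hn, mul_gammaKernel_one_div hu n.succ_pos]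
    refine mul_le_mul_of_nonneg_left (hanti ?_ ?_ ?_) (by positivity)
    · exact mul_pos hu hn'
    · exact mul_pos hu (by positivity)
    · gcongr; simp
  · have hn' : (0 : ℝ) < n := by exact_mod_cast hn
    rw [mul_gammaKernel_one_div hu hn, mul_gammaKernel_one_div hu (show 0 < n + 1 by omega),
      mul_gammaKernel_one_div hu (show 0 < n + 2 by omega), ← mul_sub, ← mul_sub]
    refine mul_le_mul_of_nonneg_left ?_ (by positivity)
    have h := hconv.2 (show u * (n : ℝ) ∈ Set.Ioi 0 from mul_pos hu hn')
      (show u * ((n + 2 : ℕ) : ℝ) ∈ Set.Ioi 0 from mul_pos hu (by positivity))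
      (show (0 : ℝ) ≤ 1 / 2 by norm_num) (show (0 : ℝ) ≤ 1 / 2 by norm_num) (by norm_num)
    have e : (1 / 2 : ℝ) • (u * (n : ℝ)) + (1 / 2 : ℝ) • (u * ((n + 2 : ℕ) : ℝ)) =
        u * ((n + 1 : ℕ) : ℝ) := by
      push_cast; simp only [smul_eq_mul]; ring
    rw [e] at h
    simp only [smul_eq_mul] at h
    linarith

lemma kernelNonneg_of_parameterConditions {p q : ℕ} {A a : Fin p → ℝ} {B b : Fin q → ℝ} {θ : ℝ}
    (hA : ∀ i, 0 < A i) (hB : ∀ j, 0 < B j) (h : ParameterConditions A a B b θ) :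
    KernelNonneg A a B b := by
  rcases h with h | h | h | h
  · exact h.2
  · exact kernelNonneg_of_sumCondition hA hB h.1.1 h.2
  · exact kernelNonneg_of_weightCondition hA hB h.2
  · exact kernelNonneg_of_blockCondition h

/-! ### Log-concave weights and a sign-change principle -/

lemma mul_succ_le_of_logConcave {M : ℕ} {u : ℕ → ℝ} (hpos : ∀ n ≤ M, 0 < u n)
    (hu : ∀ n, n + 2 ≤ M → u n * u (n + 2) ≤ u (n + 1) ^ 2) {k l : ℕ} (hkl : k ≤ l)
    (hl : l + 1 ≤ M) : u k * u (l + 1) ≤ u (k + 1) * u l := by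
  induction l, hkl using Nat.le_induction with
  | base => rw [mul_comm]
  | succ l hkl ih =>
    have h1 := ih (by omega)
    have h2 := hu l hl
    have p0 := hpos l (by omega)
    have p1 := hpos (l + 1) (by omega)
    have pk := hpos k (by omega)
    refine le_of_mul_le_mul_right ?_ p0
    calc u k * u (l + 2) * u l = u k * (u l * u (l + 2)) := by ring
      _ ≤ u k * u (l + 1) ^ 2 := by gcongr
      _ = (u k * u (l + 1)) * u (l + 1) := by ring
      _ ≤ (u (k + 1) * u l) * u (l + 1) := by gcongr
      _ = u (k + 1) * u (l + 1) * u l := by ring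

/-- For a log-concave sequence the products `uₖ uₗ` with `k + l` fixed increase towards the middle,
that is, with `k l`. -/
lemma mul_le_mul_of_logConcave {M : ℕ} {u : ℕ → ℝ} (hpos : ∀ n ≤ M, 0 < u n)
    (hu : ∀ n, n + 2 ≤ M → u n * u (n + 2) ≤ u (n + 1) ^ 2) {k l k' l' : ℕ}
    (hsum : k + l = k' + l') (hmul : k * l ≤ k' * l') (hM : k + l ≤ M) :
    u k * u l ≤ u k' * u l' := by
  have main : ∀ j k l : ℕ, k + j ≤ l → l + j ≤ M → u k * u (l + j) ≤ u (k + j) * u l := by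
    intro j
    induction j with
    | zero => intro k l _ _; simp
    | succ j ih =>
      intro k l h1 h2
      have a := mul_succ_le_of_logConcave hpos hu (show k ≤ l + j by omega) (by omega)
      have b := ih (k + 1) l (by omega) (by omega)
      rw [show k + 1 + j = k + (j + 1) by ring] at b
      exact a.trans b
  wlog hkl : k ≤ l generalizing k l
  · rw [mul_comm]
    exact this (by omega) (by rwa [mul_comm]) (by omega) (by omega)
  wlog hkl' : k' ≤ l' generalizing k' l'
  · rw [mul_comm (u k')]
    exact this (by omega) (by rwa [mul_comm l']) (by omega)
  have hk : k ≤ k' := by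
    by_contra h
    push Not at h
    have : k' * l' < k * l := by
      zify at *
      nlinarith
    omega
  have h := main (k' - k) k l' (by omega) (by omega)
  rwa [show l' + (k' - k) = l by omega, show k + (k' - k) = k' by omega] at h

/-- If a finite sum is nonnegative and the weights on its positive terms exceed those on its
negative terms, the weighted sum is nonnegative. -/
lemma sum_weight_mul_nonneg {ι : Type*} (s : Finset ι) (w T : ι → ℝ) (hw : ∀ a ∈ s, 0 ≤ w a)
    (hT : 0 ≤ ∑ a ∈ s, T a) (h : ∀ a ∈ s, ∀ b ∈ s, T a < 0 → 0 < T b → w a ≤ w b) :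
    0 ≤ ∑ a ∈ s, w a * T a := by
  classical
  rcases (s.filter fun a => T a < 0).eq_empty_or_nonempty with he | hne
  · refine Finset.sum_nonneg fun a ha => mul_nonneg (hw a ha) ?_
    by_contra hneg
    have : a ∈ s.filter fun a => T a < 0 := Finset.mem_filter.2 ⟨ha, not_le.1 hneg⟩
    simp [he] at this
  · -- the largest weight on the negative terms separates the two kinds of terms
    obtain ⟨a₀, h₀, hmax⟩ := Finset.exists_max_image _ w hne
    obtain ⟨hs₀, hn₀⟩ := Finset.mem_filter.1 h₀
    have h1 : ∑ a ∈ s, w a₀ * T a ≤ ∑ a ∈ s, w a * T a := by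
      refine Finset.sum_le_sum fun a ha => ?_
      rcases lt_trichotomy (T a) 0 with hlt | heq | hgt
      · exact mul_le_mul_of_nonpos_right (hmax a (Finset.mem_filter.2 ⟨ha, hlt⟩)) hlt.le
      · simp [heq]
      · exact mul_le_mul_of_nonneg_right (h a₀ hs₀ a ha hn₀ hgt) hgt.le
    rw [← Finset.mul_sum] at h1
    exact (mul_nonneg (hw _ hs₀) hT).trans h1

/-- The symmetrized contribution of the coefficients number `k` and `l` to a Turánian. -/
def turanTerm (c : ℕ → ℝ → ℝ) (μ α β : ℝ) (k l : ℕ) : ℝ :=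
  c k (μ + α) * c l (μ + β) + c l (μ + α) * c k (μ + β) -
    (c k μ * c l (μ + α + β) + c l μ * c k (μ + α + β))

lemma turanTerm_comm (c : ℕ → ℝ → ℝ) (μ α β : ℝ) (k l : ℕ) :
    turanTerm c μ α β k l = turanTerm c μ α β l k := by
  simp only [turanTerm]; ring

lemma two_mul_coeff_turanian (u : ℕ → ℝ) (c : ℕ → ℝ → ℝ) (μ α β : ℝ) (N : ℕ) :
    2 * PowerSeries.coeff N (turanian (weightedSeries u c) μ α β) =
      ∑ p ∈ antidiagonal N, u p.1 * u p.2 * turanTerm c μ α β p.1 p.2 := by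
  have h := coeff_turanian_weightedSeries u c μ α β N
  have h' := h
  rw [← Finset.Nat.sum_antidiagonal_swap] at h'
  rw [two_mul]
  nth_rewrite 1 [h]
  rw [h', ← Finset.sum_add_distrib]
  refine Finset.sum_congr rfl fun p _ => ?_
  simp only [Prod.fst_swap, Prod.snd_swap, turanTerm]
  ring

/-- If the symmetrized terms, ordered by `k l`, change sign at most once, from `-` to `+`, then
log-concave weights may be inserted into a nonnegative Turánian coefficient. -/
lemma coeff_turanian_nonneg_of_sign_change {u : ℕ → ℝ} (hpos : ∀ n, 0 < u n)
    (hu : ∀ n, u n * u (n + 2) ≤ u (n + 1) ^ 2) {c : ℕ → ℝ → ℝ} {μ α β : ℝ} {N : ℕ}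
    (htot : 0 ≤ PowerSeries.coeff N (turanian (weightedSeries (fun _ => 1) c) μ α β))
    (hsign : ∀ k l k' l' : ℕ, k + l = N → k' + l' = N → k * l < k' * l' →
      0 < turanTerm c μ α β k l → 0 ≤ turanTerm c μ α β k' l') :
    0 ≤ PowerSeries.coeff N (turanian (weightedSeries u c) μ α β) := by
  have h2 := two_mul_coeff_turanian u c μ α β N
  have h1 := two_mul_coeff_turanian (fun _ => 1) c μ α β N
  simp only [one_mul] at h1
  have h := sum_weight_mul_nonneg (antidiagonal N) (fun p => u p.1 * u p.2)
    (fun p => turanTerm c μ α β p.1 p.2) (fun p _ => (mul_pos (hpos _) (hpos _)).le)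
    (by rw [← h1]; positivity) ?_
  · rw [← h2] at h
    linarith
  · intro a ha b hb hTa hTb
    rw [HasAntidiagonal.mem_antidiagonal] at ha hb
    rcases le_or_gt (a.1 * a.2) (b.1 * b.2) with hle | hlt
    · exact mul_le_mul_of_logConcave (M := N) (fun n _ => hpos n) (fun n _ => hu n)
        (ha.trans hb.symm) hle ha.le
    · exact absurd (hsign _ _ _ _ hb ha hlt hTb) (not_le.2 hTa)

/-- By continuity, the coefficients of a Turánian need only be examined for `μ > 0`. -/
lemma coeff_turanian_nonneg_of_pos {u : ℕ → ℝ} {c : ℕ → ℝ → ℝ} (hc : ∀ n, Continuous (c n))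
    {α β : ℝ} {N : ℕ}
    (h : ∀ μ, 0 < μ → 0 ≤ PowerSeries.coeff N (turanian (weightedSeries u c) μ α β)) {μ : ℝ}
    (hμ : 0 ≤ μ) : 0 ≤ PowerSeries.coeff N (turanian (weightedSeries u c) μ α β) := by
  simp only [coeff_turanian_weightedSeries] at h ⊢
  have hcont : Continuous fun μ => ∑ p ∈ antidiagonal N, u p.1 * u p.2 *
      (c p.1 (μ + α) * c p.2 (μ + β) - c p.1 μ * c p.2 (μ + α + β)) := by
    have := hc
    fun_prop
  have hcl := isClosed_le (continuous_const (y := (0 : ℝ))) hcont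
  have hsub := closure_minimal (s := Set.Ioi (0 : ℝ)) (fun μ hμ => h μ hμ) hcl
  rw [closure_Ioi] at hsub
  exact hsub hμ

/-! ### The series with two-step rising factorials -/

/-- The coefficients `(μ)_{2n+2} / (2n + 1)!`. -/
def evenRisingCoeff (n : ℕ) (μ : ℝ) : ℝ := rising μ (2 * n + 2) / (2 * n + 1).factorial

/-- The symmetrized difference of products of rising factorials. -/
def risingTerm (μ α β : ℝ) (m n : ℕ) : ℝ :=
  rising (μ + α) m * rising (μ + β) n + rising (μ + α) n * rising (μ + β) m -
    (rising μ m * rising (μ + α + β) n + rising μ n * rising (μ + α + β) m)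

lemma rising_add_two (γ : ℝ) (m d : ℕ) :
    rising γ (m + d + 2) =
      rising γ m * ((γ + m) * (γ + m + d + 1) * rising (γ + m + 1) d) := by
  rw [show m + d + 2 = m + (d + 1 + 1) by ring, rising_add, rising_succ, rising_succ_left]
  push_cast
  ring

/-- An inequality of Chebyshev type for four values `w₀ ≤ w₁, w₂ ≤ w₃` of an increasing convex
weight at `0, α, β, α + β`. -/
lemma add_mul_weighted_le {p₀ p₁ p₂ p₃ w₀ w₁ w₂ w₃ : ℝ} (q₀ : 0 < p₀) (h01 : p₀ ≤ p₁)
    (h02 : p₀ ≤ p₂) (h13 : p₁ ≤ p₃) (h23 : p₂ ≤ p₃) (d1 : w₀ ≤ w₁) (d2 : w₀ ≤ w₂)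
    (d3 : w₁ - w₀ ≤ w₃ - w₂) :
    (p₀ + p₃) * (w₁ * p₁ + w₂ * p₂) ≤ (w₀ * p₀ + w₃ * p₃) * (p₁ + p₂) := by
  have q₁ := q₀.trans_le h01
  have q₂ := q₀.trans_le h02
  have q₃ := q₁.trans_le h13
  have i1 : p₀ * p₁ * (w₁ - w₀) ≤ p₂ * p₃ * (w₃ - w₂) :=
    mul_le_mul (mul_le_mul h02 h13 q₁.le q₂.le) d3 (by linarith) (by positivity)
  have i2 : p₀ * p₂ * (w₂ - w₀) ≤ p₁ * p₃ * (w₃ - w₁) :=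
    mul_le_mul (mul_le_mul h01 h23 q₂.le q₁.le) (by linarith) (by linarith) (by positivity)
  have e : (w₀ * p₀ + w₃ * p₃) * (p₁ + p₂) - (p₀ + p₃) * (w₁ * p₁ + w₂ * p₂) =
      (p₂ * p₃ * (w₃ - w₂) - p₀ * p₁ * (w₁ - w₀)) +
      (p₁ * p₃ * (w₃ - w₁) - p₀ * p₂ * (w₂ - w₀)) := by ring
  linarith

/-- Moving one step towards the middle preserves nonnegativity: with `ν = μ + m`, the quotient
`((ν)_d + (ν+α+β)_d) / ((ν+α)_d + (ν+β)_d)` decreases when `(ν, d)` becomes `(ν + 1, d - 2)`, while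
`(μ+α)_m (μ+β)_m / ((μ)_m (μ+α+β)_m)` increases with `m`. -/
lemma risingTerm_step {μ α β : ℝ} (hμ : 0 < μ) (hα : 0 ≤ α) (hβ : 0 ≤ β) {m d : ℕ}
    (h : 0 ≤ risingTerm μ α β m (m + d + 2)) : 0 ≤ risingTerm μ α β (m + 1) (m + 1 + d) := by
  set ν : ℝ := μ + m with hν
  have hν0 : 0 < ν := by positivity
  set p₀ := rising (ν + 1) d with hp₀
  set p₁ := rising (ν + α + 1) d with hp₁
  set p₂ := rising (ν + β + 1) d with hp₂
  set p₃ := rising (ν + α + β + 1) d with hp₃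
  have q₀ : 0 < p₀ := rising_pos (by positivity) d
  have q₁ : 0 < p₁ := rising_pos (by positivity) d
  have q₂ : 0 < p₂ := rising_pos (by positivity) d
  have q₃ : 0 < p₃ := rising_pos (by positivity) d
  have h01 : p₀ ≤ p₁ := rising_mono (by positivity) (by linarith) d
  have h02 : p₀ ≤ p₂ := rising_mono (by positivity) (by linarith) d
  have h13 : p₁ ≤ p₃ := rising_mono (by positivity) (by linarith) d
  have h23 : p₂ ≤ p₃ := rising_mono (by positivity) (by linarith) d
  set A := rising (μ + α) m * rising (μ + β) m with hA
  set B := rising μ m * rising (μ + α + β) m with hB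
  have A0 : 0 < A := mul_pos (rising_pos (by positivity) m) (rising_pos (by positivity) m)
  have B0 : 0 < B := mul_pos (rising_pos hμ m) (rising_pos (by positivity) m)
  let w : ℝ → ℝ := fun γ => (ν + γ) * (ν + γ + d + 1)
  have hw : ∀ γ, 0 ≤ γ → 0 < w γ := fun γ hγ => by simp only [w]; positivity
  have e1 : risingTerm μ α β m (m + d + 2) =
      A * (w α * p₁ + w β * p₂) - B * (w 0 * p₀ + w (α + β) * p₃) := by
    simp only [risingTerm, rising_add_two, w, hA, hB, hp₀, hp₁, hp₂, hp₃, hν]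
    rw [show μ + α + ↑m = μ + m + α by ring, show μ + β + ↑m = μ + m + β by ring,
      show μ + α + β + ↑m = μ + m + α + β by ring]
    ring
  have hr : ∀ γ : ℝ, rising γ (m + 1 + d) = rising γ m * ((γ + m) * rising (γ + m + 1) d) := by
    intro γ
    rw [add_assoc, rising_add, add_comm 1 d, rising_succ_left]
  have e2 : risingTerm μ α β (m + 1) (m + 1 + d) =
      A * ((ν + α) * (ν + β)) * (p₁ + p₂) - B * (ν * (ν + α + β)) * (p₀ + p₃) := by
    simp only [risingTerm, hr, rising_succ, hA, hB, hp₀, hp₁, hp₂, hp₃, hν]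
    rw [show μ + α + ↑m = μ + m + α by ring, show μ + β + ↑m = μ + m + β by ring,
      show μ + α + β + ↑m = μ + m + α + β by ring]
    ring
  rw [e1, sub_nonneg] at h
  rw [e2, sub_nonneg]
  set Y := w α * p₁ + w β * p₂
  set Z := w 0 * p₀ + w (α + β) * p₃
  have hY : 0 < Y := add_pos (mul_pos (hw α hα) q₁) (mul_pos (hw β hβ) q₂)
  have key : (p₀ + p₃) * Y ≤ Z * (p₁ + p₂) := by
    have hαβ := mul_nonneg hα hβ
    refine add_mul_weighted_le q₀ h01 h02 h13 h23 (sub_nonneg.1 ?_) (sub_nonneg.1 ?_)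
      (sub_nonneg.1 ?_)
    · have : w α - w 0 = α * (2 * ν + α + d + 1) := by simp only [w]; ring
      rw [this]; positivity
    · have : w β - w 0 = β * (2 * ν + β + d + 1) := by simp only [w]; ring
      rw [this]; positivity
    · have : w (α + β) - w β - (w α - w 0) = 2 * (α * β) := by simp only [w]; ring
      rw [this]; positivity
  have hxy : ν * (ν + α + β) ≤ (ν + α) * (ν + β) := by
    have := mul_nonneg hα hβ
    have e : (ν + α) * (ν + β) = ν * (ν + α + β) + α * β := by ring
    linarith
  refine le_of_mul_le_mul_right ?_ hY
  calc B * (ν * (ν + α + β)) * (p₀ + p₃) * Y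
      = B * (ν * (ν + α + β)) * ((p₀ + p₃) * Y) := by ring
    _ ≤ B * (ν * (ν + α + β)) * (Z * (p₁ + p₂)) := by gcongr
    _ = (B * Z) * ((ν * (ν + α + β)) * (p₁ + p₂)) := by ring
    _ ≤ (A * Y) * (((ν + α) * (ν + β)) * (p₁ + p₂)) := by gcongr
    _ = A * ((ν + α) * (ν + β)) * (p₁ + p₂) * Y := by ring

lemma risingTerm_nonneg_of_steps {μ α β : ℝ} (hμ : 0 < μ) (hα : 0 ≤ α) (hβ : 0 ≤ β)
    (j : ℕ) {m n : ℕ} (hmn : m + j ≤ n) (h : 0 ≤ risingTerm μ α β m (n + j)) :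
    0 ≤ risingTerm μ α β (m + j) n := by
  induction j generalizing m n with
  | zero => exact h
  | succ j ih =>
    have h1 := risingTerm_step hμ hα hβ (m := m) (d := n + j + 1 - m - 2) (by
      rwa [show m + (n + j + 1 - m - 2) + 2 = n + (j + 1) by omega])
    rw [show m + 1 + (n + j + 1 - m - 2) = n + j by omega] at h1
    have h2 := ih (m := m + 1) (n := n) (by omega) h1
    rwa [show m + 1 + j = m + (j + 1) by ring] at h2

lemma turanTerm_evenRisingCoeff (μ α β : ℝ) (k l : ℕ) :
    turanTerm evenRisingCoeff μ α β k l =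
      risingTerm μ α β (2 * k + 2) (2 * l + 2) /
        ((2 * k + 1).factorial * (2 * l + 1).factorial) := by
  simp only [turanTerm, evenRisingCoeff, risingTerm]
  field_simp

lemma turanTerm_evenRisingCoeff_sign {μ α β : ℝ} (hμ : 0 < μ) (hα : 0 ≤ α) (hβ : 0 ≤ β)
    {k l k' l' : ℕ} (hsum : k + l = k' + l') (hmul : k * l < k' * l')
    (h : 0 < turanTerm evenRisingCoeff μ α β k l) :
    0 ≤ turanTerm evenRisingCoeff μ α β k' l' := by
  wlog hkl : k ≤ l generalizing k l
  · exact this (k := l) (l := k) (by omega) (by rwa [mul_comm l k])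
      (by rwa [turanTerm_comm _ _ _ _ l k]) (by omega)
  wlog hkl' : k' ≤ l' generalizing k' l'
  · rw [turanTerm_comm]
    exact this (by omega) (by rwa [mul_comm l']) (by omega)
  have hk : k ≤ k' := by
    by_contra hc
    push Not at hc
    have : k' * l' < k * l := by
      zify at *
      nlinarith
    omega
  rw [turanTerm_evenRisingCoeff] at h ⊢
  have h1 : 0 < risingTerm μ α β (2 * k + 2) (2 * l + 2) := by
    by_contra hc
    exact absurd h (not_lt.2 (div_nonpos_of_nonpos_of_nonneg (not_lt.1 hc) (by positivity)))
  have h2 := risingTerm_nonneg_of_steps hμ hα hβ (2 * (k' - k)) (m := 2 * k + 2) (n := 2 * l' + 2)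
    (by omega) (by rw [show 2 * l' + 2 + 2 * (k' - k) = 2 * l + 2 by omega]; exact h1.le)
  rw [show 2 * k + 2 + 2 * (k' - k) = 2 * k' + 2 by omega] at h2
  positivity

/-- With `x = y²`, the family `∑ (μ)_{2n+2} / (2n+1)! xⁿ` is
`μ ((1 - y) ^ (-μ-1) - (1 + y) ^ (-μ-1)) / (2 y)`. -/
lemma two_smul_X_mul_expand_evenRising (μ : ℝ) :
    (2 : ℝ) • (PowerSeries.X * PowerSeries.expand 2 two_ne_zero
      (weightedSeries (fun _ => 1) evenRisingCoeff μ)) =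
      μ • (binomSeries 1 (μ + 1) - binomSeries (-1) (μ + 1)) := by
  ext n
  rw [map_smul, map_smul, map_sub, smul_eq_mul, smul_eq_mul]
  cases n with
  | zero => simp [binomSeries, binomPoly_eval, rising_zero]
  | succ n =>
    rw [PowerSeries.coeff_succ_X_mul]
    simp only [binomSeries, PowerSeries.coeff_mk, binomPoly_eval, one_pow, mul_one]
    rcases Nat.even_or_odd' n with ⟨m, rfl | rfl⟩
    · rw [PowerSeries.coeff_expand_mul, weightedSeries, PowerSeries.coeff_mk, evenRisingCoeff,
        show 2 * m + 2 = (2 * m + 1) + 1 by ring, rising_succ_left,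
        (odd_two_mul_add_one m).neg_one_pow]
      ring
    · rw [PowerSeries.coeff_expand_of_not_dvd _ _ _ (by omega),
        show 2 * m + 1 + 1 = 2 * (m + 1) by ring, pow_mul, neg_one_sq, one_pow]
      ring

/-- For unit weights the Turánian is, up to the factor `4 y²`, the sum of
`αβ (P^{μ+α+1} - Q^{μ+α+1}) (P^{μ+β+1} - Q^{μ+β+1})` and
`μ (μ+α+β) (PQ)^{μ+1} (P^α - Q^α) (P^β - Q^β)`, where `P = 1 / (1 - y)` and `Q = 1 / (1 + y)`. -/
lemma coeff_turanian_evenRising_one_nonneg {μ α β : ℝ} (hμ : 0 ≤ μ) (hα : 0 ≤ α) (hβ : 0 ≤ β)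
    (N : ℕ) :
    0 ≤ PowerSeries.coeff N (turanian (weightedSeries (fun _ => 1) evenRisingCoeff) μ α β) := by
  set G := weightedSeries (fun _ => 1) evenRisingCoeff
  set P := binomSeries 1
  set Q := binomSeries (-1)
  have hP : ∀ x y, P (x + y) = P x * P y := binomSeries_add 1
  have hQ : ∀ x y, Q (x + y) = Q x * Q y := binomSeries_add (-1)
  have h1 : |(-1 : ℝ)| ≤ 1 := by norm_num
  have hid : (4 : ℝ) • (PowerSeries.X ^ 2 * PowerSeries.expand 2 two_ne_zero (turanian G μ α β)) =
      (α * β) • ((P (μ + α + 1) - Q (μ + α + 1)) * (P (μ + β + 1) - Q (μ + β + 1))) +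
      (μ * (μ + α + β)) • (P (μ + 1) * Q (μ + 1) * ((P α - Q α) * (P β - Q β))) := by
    have e : (4 : ℝ) • (PowerSeries.X ^ 2 *
        PowerSeries.expand 2 two_ne_zero (turanian G μ α β)) =
        ((2 : ℝ) • (PowerSeries.X * PowerSeries.expand 2 two_ne_zero (G (μ + α)))) *
          ((2 : ℝ) • (PowerSeries.X * PowerSeries.expand 2 two_ne_zero (G (μ + β)))) -
        ((2 : ℝ) • (PowerSeries.X * PowerSeries.expand 2 two_ne_zero (G μ))) *
          ((2 : ℝ) • (PowerSeries.X * PowerSeries.expand 2 two_ne_zero (G (μ + α + β)))) := by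
      simp only [turanian, map_sub, map_mul, smul_mul_smul_comm]
      rw [← smul_sub]
      congr 1
      · norm_num
      · ring
    rw [e]
    simp only [G, two_smul_X_mul_expand_evenRising, smul_mul_smul_comm]
    rw [show μ + α + 1 = (μ + 1) + α by ring, show μ + β + 1 = (μ + 1) + β by ring,
      show μ + α + β + 1 = (μ + 1) + α + β by ring]
    simp only [← show P = binomSeries 1 from rfl, ← show Q = binomSeries (-1) from rfl, hP, hQ,
      PowerSeries.smul_eq_C_mul, map_mul, map_add]
    ring
  have hnn : CoeffNonneg
      ((α * β) • ((P (μ + α + 1) - Q (μ + α + 1)) * (P (μ + β + 1) - Q (μ + β + 1))) +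
      (μ * (μ + α + β)) • (P (μ + 1) * Q (μ + 1) * ((P α - Q α) * (P β - Q β)))) :=
    ((((coeffNonneg_binomSeries_sub h1 (by positivity)).mul
      (coeffNonneg_binomSeries_sub h1 (by positivity))).smul (by positivity)).add
      (((coeffNonneg_binomSeries_mul h1 (by positivity)).mul
        ((coeffNonneg_binomSeries_sub h1 hα).mul (coeffNonneg_binomSeries_sub h1 hβ))).smul
        (by positivity)))
  have h := hnn (2 * N + 2)
  rw [← hid, map_smul, PowerSeries.coeff_X_pow_mul, PowerSeries.coeff_expand_mul, smul_eq_mul] at h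
  linarith

lemma continuous_evenRisingCoeff (n : ℕ) : Continuous (evenRisingCoeff n) :=
  (continuous_rising _).div_const _

theorem coeff_turanian_evenRising_nonneg {u : ℕ → ℝ} (hpos : ∀ n, 0 < u n)
    (hu : ∀ n, u n * u (n + 2) ≤ u (n + 1) ^ 2) {μ α β : ℝ} (hμ : 0 ≤ μ) (hα : 0 ≤ α)
    (hβ : 0 ≤ β) (N : ℕ) :
    0 ≤ PowerSeries.coeff N (turanian (weightedSeries u evenRisingCoeff) μ α β) := by
  refine coeff_turanian_nonneg_of_pos continuous_evenRisingCoeff (fun μ hμ => ?_) hμ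
  exact coeff_turanian_nonneg_of_sign_change hpos hu
    (coeff_turanian_evenRising_one_nonneg hμ.le hα hβ N)
    fun k l k' l' h1 h2 h3 h4 =>
      turanTerm_evenRisingCoeff_sign hμ hα hβ (h1.trans h2.symm) h3 h4

/-! ### Powers of the Catalan generating function with log-concave weights -/

/-- The polynomials `catPoly` as a family of coefficients. -/
def catCoeff (n : ℕ) (μ : ℝ) : ℝ := (catPoly n).eval μ

lemma catCoeff_pos {μ : ℝ} (hμ : 0 < μ) (n : ℕ) : 0 < catCoeff n μ := by
  rw [catCoeff, catPoly_eval hμ.le]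
  have h1 := rising_pos hμ (2 * n)
  have h2 := rising_pos (show 0 < μ + 1 by linarith) n
  positivity

lemma catCoeff_mul_rising {μ : ℝ} (hμ : 0 < μ) (k j : ℕ) :
    catCoeff k (μ + j) * (μ * rising (μ + k + 1) j) =
      catCoeff k μ * ((μ + j) * rising (μ + 2 * k) j) := by
  have hj : 0 < μ + j := by positivity
  have e1 : rising μ (2 * k) * rising (μ + 2 * k) j = rising μ j * rising (μ + j) (2 * k) := by
    have h1 := rising_add μ (2 * k) j
    have h2 := rising_add μ j (2 * k)
    rw [add_comm (2 * k) j, h2] at h1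
    push_cast at h1
    exact h1.symm
  have e2 : rising (μ + 1) k * rising (μ + k + 1) j =
      rising (μ + 1) j * rising (μ + j + 1) k := by
    have h1 := rising_add (μ + 1) k j
    have h2 := rising_add (μ + 1) j k
    rw [add_comm k j, h2] at h1
    rw [show μ + 1 + (k : ℝ) = μ + k + 1 by ring, show μ + 1 + (j : ℝ) = μ + j + 1 by ring] at h1
    exact h1.symm
  have e3 : rising μ j * (μ + j) = μ * rising (μ + 1) j := by
    rw [← rising_succ, rising_succ_left]
  rw [catCoeff, catCoeff, catPoly_eval hμ.le, catPoly_eval hj.le]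
  have p1 := rising_pos (show 0 < μ + 1 by linarith) k
  have p2 := rising_pos (show 0 < μ + j + 1 by linarith) k
  rw [div_mul_eq_mul_div, div_mul_eq_mul_div, div_eq_div_iff (by positivity) (by positivity)]
  have p3 := rising_pos (show 0 < μ + 1 by linarith) j
  refine mul_right_cancel₀ p3.ne' ?_
  linear_combination
    (rising (μ + j) (2 * k) * μ * k.factorial * rising (μ + 1) j) * e2 +
    (- k.factorial * rising (μ + j + 1) k * rising (μ + 1) j * (μ + j)) * e1 +
    (- k.factorial * rising (μ + j + 1) k * rising (μ + 1) j * rising (μ + j) (2 * k)) * e3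

/-- Up to the factor `(μ + j) / μ`, the numerator of `cₓ(μ + j) / cₓ(μ)` over the common denominator
`(μ + x + 1)_{j+i}`. -/
def catQuot (μ : ℝ) (i j : ℕ) (x : ℝ) : ℝ := rising (μ + 2 * x) j * rising (μ + x + 1 + j) i

/-- The polynomial in `k` and `l` that carries the sign of the symmetrized term for the shifts
`a` and `b`. -/
def catForm (a b : ℕ) (μ x y : ℝ) : ℝ :=
  (μ + a) * (μ + b) *
      (catQuot μ b a x * catQuot μ a b y + catQuot μ b a y * catQuot μ a b x) -
    μ * (μ + a + b) *
      (catQuot μ (a + b) 0 x * catQuot μ 0 (a + b) y +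
        catQuot μ (a + b) 0 y * catQuot μ 0 (a + b) x)

lemma catCoeff_mul_rising_add {μ : ℝ} (hμ : 0 < μ) (k i j : ℕ) :
    catCoeff k (μ + j) * (μ * rising (μ + k + 1) (j + i)) =
      catCoeff k μ * ((μ + j) * catQuot μ i j k) := by
  rw [rising_add, catQuot]
  linear_combination rising (μ + k + 1 + j) i * catCoeff_mul_rising hμ k j

lemma turanTerm_catCoeff_mul {μ : ℝ} (hμ : 0 < μ) (a b k l : ℕ) :
    turanTerm catCoeff μ a b k l *
        ((μ * rising (μ + k + 1) (a + b)) * (μ * rising (μ + l + 1) (a + b))) =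
      catCoeff k μ * catCoeff l μ * catForm a b μ k l := by
  have h1 := fun k => catCoeff_mul_rising_add hμ k b a
  have h2 := fun k => catCoeff_mul_rising_add hμ k a b
  have h3 := fun k => catCoeff_mul_rising_add hμ k 0 (a + b)
  have h0 := fun k => catCoeff_mul_rising_add hμ k (a + b) 0
  simp only [add_comm b a, add_zero, zero_add, Nat.cast_zero, Nat.cast_add] at h1 h2 h3 h0
  simp only [turanTerm, catForm, ← add_assoc] at *
  set Rk := μ * rising (μ + k + 1) (a + b)
  set Rl := μ * rising (μ + l + 1) (a + b)
  have e : ∀ s t s' t' v w v' w' : ℝ, (s * t + s' * t' - (v * w + v' * w')) * (Rk * Rl) =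
      (s * Rk) * (t * Rl) + (s' * Rl) * (t' * Rk) -
        ((v * Rk) * (w * Rl) + (v' * Rl) * (w' * Rk)) := by
    intros; ring
  rw [e, h1 k, h1 l, h2 k, h2 l, h3 k, h3 l, h0 k, h0 l]
  ring

/-- For fixed `k + l = N` the form is a polynomial `q₀ + q₁ P + ⋯ + q₄ P⁴` in `P = k l` whose
coefficients, apart from zeros, change sign at most once, from `-` to `+`. -/
def CatFormSign (a b : ℕ) : Prop :=
  ∀ μ N : ℝ, 0 < μ → 0 ≤ N → 0 ≤ N * (N - 1) → ∃ q₀ q₁ q₂ q₃ q₄ : ℝ,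
    q₀ ≤ 0 ∧ 0 ≤ q₃ ∧ 0 ≤ q₄ ∧ (0 ≤ q₂ ∨ q₁ ≤ 0) ∧ ∀ x y : ℝ, x + y = N →
      catForm a b μ x y =
        q₀ + q₁ * (x * y) + q₂ * (x * y) ^ 2 + q₃ * (x * y) ^ 3 + q₄ * (x * y) ^ 4

/-- Descartes' rule of signs in the form needed here: after division by `P` or `P²` the polynomial
becomes increasing. -/
lemma poly_nonneg_of_sign_change {q₀ q₁ q₂ q₃ q₄ P P' : ℝ} (h0 : q₀ ≤ 0) (h3 : 0 ≤ q₃)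
    (h4 : 0 ≤ q₄) (h : 0 ≤ q₂ ∨ q₁ ≤ 0) (hP : 0 ≤ P) (hPP : P ≤ P')
    (hQ : 0 < q₀ + q₁ * P + q₂ * P ^ 2 + q₃ * P ^ 3 + q₄ * P ^ 4) :
    0 ≤ q₀ + q₁ * P' + q₂ * P' ^ 2 + q₃ * P' ^ 3 + q₄ * P' ^ 4 := by
  have hP0 : 0 < P := by
    refine lt_of_le_of_ne hP fun h => ?_
    rw [← h] at hQ
    norm_num at hQ
    linarith
  have hP0' : 0 < P' := hP0.trans_le hPP
  have d1 : 0 ≤ P' - P := sub_nonneg.2 hPP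
  have d2 : 0 ≤ P' ^ 2 - P ^ 2 := sub_nonneg.2 (by gcongr)
  have d3 : 0 ≤ P' ^ 3 - P ^ 3 := sub_nonneg.2 (by gcongr)
  have h0' : 0 ≤ -q₀ := by linarith
  rcases h with h2 | h1
  · refine nonneg_of_mul_nonneg_left (b := P) ?_ hP0
    have e : (q₀ + q₁ * P' + q₂ * P' ^ 2 + q₃ * P' ^ 3 + q₄ * P' ^ 4) * P =
        (q₀ + q₁ * P + q₂ * P ^ 2 + q₃ * P ^ 3 + q₄ * P ^ 4) * P' + (-q₀ * (P' - P) +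
          q₂ * (P * P' * (P' - P)) + q₃ * (P * P' * (P' ^ 2 - P ^ 2)) +
          q₄ * (P * P' * (P' ^ 3 - P ^ 3))) := by ring
    rw [e]
    positivity
  · have h1' : 0 ≤ -q₁ := by linarith
    refine nonneg_of_mul_nonneg_left (b := P ^ 2) ?_ (by positivity)
    have e : (q₀ + q₁ * P' + q₂ * P' ^ 2 + q₃ * P' ^ 3 + q₄ * P' ^ 4) * P ^ 2 =
        (q₀ + q₁ * P + q₂ * P ^ 2 + q₃ * P ^ 3 + q₄ * P ^ 4) * P' ^ 2 +
          (-q₀ * (P' ^ 2 - P ^ 2) + -q₁ * (P * P' * (P' - P)) +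
          q₃ * (P ^ 2 * P' ^ 2 * (P' - P)) + q₄ * (P ^ 2 * P' ^ 2 * (P' ^ 2 - P ^ 2))) := by ring
    rw [e]
    positivity

/-- All coefficients except `q₀` are nonnegative. -/
lemma catForm_sign_one_one : CatFormSign 1 1 := by
  intro μ N hμ hN hN1
  refine ⟨-(μ * (N * (N - 1)) *
      (8 + 14 * μ + 7 * μ ^ 2 + μ ^ 3)),
    32 + 104 * μ + 98 * μ ^ 2 + 34 * μ ^ 3 + 4 * μ ^ 4 +
      (16 + 16 * μ + 2 * μ ^ 2) * N,
    8,
    0,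
    0, ?_, by positivity, by positivity, Or.inl (by positivity), ?_⟩
  · rw [neg_nonpos]; positivity
  · intro x y hxy
    subst hxy
    simp only [catForm, catQuot, rising_succ, rising_zero]
    push_cast
    ring

/-- Only `q₀` and, for `N` large compared with `μ`, `q₁` are negative. -/
lemma catForm_sign_one_two : CatFormSign 1 2 := by
  intro μ N hμ hN hN1
  refine ⟨-(μ * (N * (N - 1)) *
      (72 + 204 * μ + 216 * μ ^ 2 + 106 * μ ^ 3 + 24 * μ ^ 4 + 2 * μ ^ 5 +
      (84 + 172 * μ + 117 * μ ^ 2 + 32 * μ ^ 3 + 3 * μ ^ 4) * N)),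
    288 + 1224 * μ + 1896 * μ ^ 2 + 1440 * μ ^ 3 + 564 * μ ^ 4 + 108 * μ ^ 5 + 8 * μ ^ 6 +
      (456 + 1440 * μ + 1568 * μ ^ 2 + 738 * μ ^ 3 + 154 * μ ^ 4 + 12 * μ ^ 5) * N +
      (120 + 84 * μ - 34 * μ ^ 2 - 30 * μ ^ 3 - 4 * μ ^ 4) * N ^ 2,
    320 + 840 * μ + 616 * μ ^ 2 + 168 * μ ^ 3 + 16 * μ ^ 4 +
      (136 + 96 * μ + 8 * μ ^ 2) * N,
    32,
    0, ?_, by positivity, by positivity, Or.inl (by positivity), ?_⟩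
  · rw [neg_nonpos]; positivity
  · intro x y hxy
    subst hxy
    simp only [catForm, catQuot, rising_succ, rising_zero]
    push_cast
    ring

/-- Here `q₂` can be negative, but only for `μ > 3` and `N > 6 μ + 10`, where `q₁` is negative
too. -/
lemma catForm_sign_one_three : CatFormSign 1 3 := by
  intro μ N hμ hN hN1
  refine ⟨-(μ * (N * (N - 1)) *
      (1152 + 3984 * μ + 5628 * μ ^ 2 + 4212 * μ ^ 3 + 1803 * μ ^ 4 + 441 * μ ^ 5 + 57 * μ ^ 6 +
        3 * μ ^ 7 +
      (1920 + 5536 * μ + 6216 * μ ^ 2 + 3490 * μ ^ 3 + 1035 * μ ^ 4 + 154 * μ ^ 5 + 9 * μ ^ 6) * N +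
      (912 + 2068 * μ + 1680 * μ ^ 2 + 625 * μ ^ 3 + 108 * μ ^ 4 + 7 * μ ^ 5) * N ^ 2)),
    4608 + 22848 * μ + 43592 * μ ^ 2 + 44196 * μ ^ 3 + 26516 * μ ^ 4 + 9678 * μ ^ 5 +
        2096 * μ ^ 6 + 246 * μ ^ 7 + 12 * μ ^ 8 +
      (9984 + 38976 * μ + 59814 * μ ^ 2 + 47619 * μ ^ 3 + 21243 * μ ^ 4 + 5301 * μ ^ 5 +
        687 * μ ^ 6 + 36 * μ ^ 7) * N +
      (7200 + 19596 * μ + 20936 * μ ^ 2 + 10797 * μ ^ 3 + 2807 * μ ^ 4 + 351 * μ ^ 5 +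
        17 * μ ^ 6) * N ^ 2 +
      (1248 + 612 * μ - 1026 * μ ^ 2 - 870 * μ ^ 3 - 222 * μ ^ 4 - 18 * μ ^ 5) * N ^ 3,
    1824 + 12096 * μ + 18680 * μ ^ 2 + 12762 * μ ^ 3 + 4316 * μ ^ 4 + 702 * μ ^ 5 + 44 * μ ^ 6 +
      (5928 + 16620 * μ + 15450 * μ ^ 2 + 6144 * μ ^ 3 + 1086 * μ ^ 4 + 72 * μ ^ 5) * N +
      (1560 + 1176 * μ + 48 * μ ^ 2 - 96 * μ ^ 3 - 12 * μ ^ 4) * N ^ 2,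
    1632 + 4152 * μ + 2616 * μ ^ 2 + 600 * μ ^ 3 + 48 * μ ^ 4 +
      (696 + 384 * μ + 24 * μ ^ 2) * N,
    96, ?_, by positivity, by positivity, ?_, ?_⟩
  · rw [neg_nonpos]; positivity
  · rcases le_or_gt μ 3 with h3 | h3
    · left
      -- the coefficient of `N ^ 2` in `q₂`
      have hT : 0 ≤ 1560 + 1176 * μ + 48 * μ ^ 2 - 96 * μ ^ 3 - 12 * μ ^ 4 := by
        have h1 : μ ^ 2 ≤ 3 * μ := by nlinarith
        have h2 : μ ^ 3 ≤ 9 * μ := by nlinarith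
        have h4 : μ ^ 4 ≤ 27 * μ := by nlinarith
        nlinarith
      positivity
    · rcases le_or_gt N (6 * μ + 10) with hle | hgt
      · left
        -- `q₂` is the sum of the terms in `hd` and `hr`
        have hd := mul_nonneg (show 0 ≤ 96 * μ ^ 3 + 12 * μ ^ 4 by positivity)
          (mul_nonneg hN (sub_nonneg.2 hle))
        have hr : 0 ≤ 1824 + 12096 * μ + 18680 * μ ^ 2 + 12762 * μ ^ 3 + 4316 * μ ^ 4 +
          702 * μ ^ 5 + 44 * μ ^ 6 +
          (5928 + 16620 * μ + 15450 * μ ^ 2 + 5184 * μ ^ 3 + 390 * μ ^ 4) * N +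
          (1560 + 1176 * μ + 48 * μ ^ 2) * N ^ 2 := by positivity
        refine (add_nonneg hd hr).trans_eq ?_
        ring
      · right
        obtain ⟨m, rfl⟩ : ∃ m, μ = 3 + m := ⟨μ - 3, by ring⟩
        obtain ⟨n, rfl⟩ : ∃ n, N = 6 * (3 + m) + 10 + n := ⟨N - (6 * (3 + m) + 10), by ring⟩
        have hm : 0 < m := by linarith
        have hn : 0 < n := by linarith
        -- in the variables `m` and `n` all coefficients of `q₁` are negative
        rw [← neg_nonneg]
        ring_nf
        positivity
  · intro x y hxy
    subst hxy
    simp only [catForm, catQuot, rising_succ, rising_zero]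
    push_cast
    ring

/-- Here `q₂` can be negative, but only for `μ > 3` and `N > 6 μ`, where `q₁` is negative too. -/
lemma catForm_sign_two_two : CatFormSign 2 2 := by
  intro μ N hμ hN hN1
  refine ⟨-(μ * (N * (N - 1)) *
      (1152 + 4464 * μ + 6844 * μ ^ 2 + 5386 * μ ^ 3 + 2368 * μ ^ 4 + 586 * μ ^ 5 + 76 * μ ^ 6 +
        4 * μ ^ 7 +
      (2880 + 8088 * μ + 8838 * μ ^ 2 + 4845 * μ ^ 3 + 1410 * μ ^ 4 + 207 * μ ^ 5 +
        12 * μ ^ 6) * N +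
      (1152 + 2616 * μ + 2130 * μ ^ 2 + 795 * μ ^ 3 + 138 * μ ^ 4 + 9 * μ ^ 5) * N ^ 2)),
    4608 + 22848 * μ + 47944 * μ ^ 2 + 53060 * μ ^ 3 + 33716 * μ ^ 4 + 12688 * μ ^ 5 +
        2784 * μ ^ 6 + 328 * μ ^ 7 + 16 * μ ^ 8 +
      (11904 + 52544 * μ + 83900 * μ ^ 2 + 66876 * μ ^ 3 + 29424 * μ ^ 4 + 7224 * μ ^ 5 +
        924 * μ ^ 6 + 48 * μ ^ 7) * N +
      (5760 + 19152 * μ + 22440 * μ ^ 2 + 12092 * μ ^ 3 + 3216 * μ ^ 4 + 408 * μ ^ 5 +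
        20 * μ ^ 6) * N ^ 2 +
      (768 - 272 * μ - 1820 * μ ^ 2 - 1236 * μ ^ 3 - 300 * μ ^ 4 - 24 * μ ^ 5) * N ^ 3,
    19232 + 47552 * μ + 47880 * μ ^ 2 + 25284 * μ ^ 3 + 7300 * μ ^ 4 + 1080 * μ ^ 5 + 64 * μ ^ 6 +
      (12576 + 27808 * μ + 22804 * μ ^ 2 + 8520 * μ ^ 3 + 1464 * μ ^ 4 + 96 * μ ^ 5) * N +
      (1984 + 1520 * μ + 52 * μ ^ 2 - 128 * μ ^ 3 - 16 * μ ^ 4) * N ^ 2,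
    3232 + 6080 * μ + 3552 * μ ^ 2 + 800 * μ ^ 3 + 64 * μ ^ 4 +
      (960 + 512 * μ + 32 * μ ^ 2) * N,
    128, ?_, by positivity, by positivity, ?_, ?_⟩
  · rw [neg_nonpos]; positivity
  · rcases le_or_gt μ 3 with h3 | h3
    · left
      -- the coefficient of `N ^ 2` in `q₂`
      have hT : 0 ≤ 1984 + 1520 * μ + 52 * μ ^ 2 - 128 * μ ^ 3 - 16 * μ ^ 4 := by
        have h1 : μ ^ 2 ≤ 3 * μ := by nlinarith
        have h2 : μ ^ 3 ≤ 9 * μ := by nlinarith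
        have h4 : μ ^ 4 ≤ 27 * μ := by nlinarith
        nlinarith
      positivity
    · rcases le_or_gt N (6 * μ) with hle | hgt
      · left
        -- `q₂` is the sum of the terms in `hd` and `hr`
        have hd := mul_nonneg (show 0 ≤ 128 * μ ^ 3 + 16 * μ ^ 4 by positivity)
          (mul_nonneg hN (sub_nonneg.2 hle))
        have hr : 0 ≤ 19232 + 47552 * μ + 47880 * μ ^ 2 + 25284 * μ ^ 3 + 7300 * μ ^ 4 +
          1080 * μ ^ 5 + 64 * μ ^ 6 +
          (12576 + 27808 * μ + 22804 * μ ^ 2 + 8520 * μ ^ 3 + 696 * μ ^ 4) * N +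
          (1984 + 1520 * μ + 52 * μ ^ 2) * N ^ 2 := by positivity
        refine (add_nonneg hd hr).trans_eq ?_
        ring
      · right
        obtain ⟨m, rfl⟩ : ∃ m, μ = 3 + m := ⟨μ - 3, by ring⟩
        obtain ⟨n, rfl⟩ : ∃ n, N = 6 * (3 + m) + n := ⟨N - (6 * (3 + m)), by ring⟩
        have hm : 0 < m := by linarith
        have hn : 0 < n := by linarith
        -- in the variables `m` and `n` all coefficients of `q₁` are negative
        rw [← neg_nonneg]
        ring_nf
        positivity
  · intro x y hxy
    subst hxy
    simp only [catForm, catQuot, rising_succ, rising_zero]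
    push_cast
    ring

lemma turanTerm_catCoeff_sign {a b : ℕ} (hab : CatFormSign a b) {μ : ℝ} (hμ : 0 < μ)
    {k l k' l' : ℕ} (hsum : k + l = k' + l') (hmul : k * l < k' * l')
    (h : 0 < turanTerm catCoeff μ a b k l) : 0 ≤ turanTerm catCoeff μ a b k' l' := by
  have hR : ∀ k : ℕ, 0 < μ * rising (μ + k + 1) (a + b) := fun k =>
    mul_pos hμ (rising_pos (by positivity) _)
  have hN1 : (0 : ℝ) ≤ ((k + l : ℕ) : ℝ) * (((k + l : ℕ) : ℝ) - 1) := by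
    rcases Nat.eq_zero_or_pos (k + l) with h0 | h0
    · simp [h0]
    · have : (1 : ℝ) ≤ ((k + l : ℕ) : ℝ) := by exact_mod_cast h0
      exact mul_nonneg (by positivity) (by linarith)
  obtain ⟨q₀, q₁, q₂, q₃, q₄, h0, h3, h4, h12, hq⟩ := hab μ ((k + l : ℕ) : ℝ) hμ (by positivity) hN1
  have hF : 0 < catForm a b μ k l := by
    have h1 := mul_pos h (mul_pos (hR k) (hR l))
    rw [turanTerm_catCoeff_mul hμ] at h1
    exact (mul_pos_iff_of_pos_left (mul_pos (catCoeff_pos hμ k) (catCoeff_pos hμ l))).1 h1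
  have hF' : 0 ≤ catForm a b μ k' l' := by
    rw [hq _ _ (by push_cast; ring)] at hF
    rw [hq _ _ (by rw [hsum]; push_cast; ring)]
    exact poly_nonneg_of_sign_change h0 h3 h4 h12 (by positivity) (by exact_mod_cast hmul.le) hF
  have h1 := mul_nonneg (mul_pos (catCoeff_pos hμ k') (catCoeff_pos hμ l')).le hF'
  rw [← turanTerm_catCoeff_mul hμ] at h1
  exact nonneg_of_mul_nonneg_left h1 (mul_pos (hR k') (hR l'))

lemma weightedSeries_one_catCoeff (μ : ℝ) :
    weightedSeries (fun _ => 1) catCoeff μ = catSeries 1 μ := by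
  ext n
  simp [weightedSeries, catCoeff, catSeries]

lemma turanian_comm (F : ℝ → ℝ⟦X⟧) (μ α β : ℝ) : turanian F μ α β = turanian F μ β α := by
  rw [turanian, turanian, mul_comm (F (μ + α)), add_right_comm]

lemma turanian_zero (F : ℝ → ℝ⟦X⟧) (μ β : ℝ) : turanian F μ 0 β = 0 := by
  rw [turanian, add_zero, sub_self]

lemma continuous_catCoeff (n : ℕ) : Continuous (catCoeff n) := (catPoly n).continuous

/-- For unit weights the Turánians vanish, and each of the shifts considered produces a single sign
change. -/
lemma coeff_turanian_catCoeff_of_catFormSign {u : ℕ → ℝ} (hpos : ∀ n, 0 < u n)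
    (hu : ∀ n, u n * u (n + 2) ≤ u (n + 1) ^ 2) {μ : ℝ} (hμ : 0 ≤ μ) {a b : ℕ}
    (hab : CatFormSign a b) (N : ℕ) :
    0 ≤ PowerSeries.coeff N (turanian (weightedSeries u catCoeff) μ a b) := by
  refine coeff_turanian_nonneg_of_pos continuous_catCoeff (fun μ hμ => ?_) hμ
  refine coeff_turanian_nonneg_of_sign_change hpos hu (le_of_eq ?_)
    fun k l k' l' h1 h2 h3 h4 => turanTerm_catCoeff_sign hab hμ (h1.trans h2.symm) h3 h4
  have : turanian (weightedSeries (fun _ => 1) catCoeff) μ a b = 0 := by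
    simp only [turanian, weightedSeries_one_catCoeff, catSeries_add]
    ring
  rw [this, map_zero]

theorem coeff_turanian_catCoeff_nonneg {u : ℕ → ℝ} (hpos : ∀ n, 0 < u n)
    (hu : ∀ n, u n * u (n + 2) ≤ u (n + 1) ^ 2) {μ : ℝ} (hμ : 0 ≤ μ) {a b : ℕ} (hab : a + b ≤ 4)
    (N : ℕ) : 0 ≤ PowerSeries.coeff N (turanian (weightedSeries u catCoeff) μ a b) := by
  wlog hle : a ≤ b generalizing a b
  · rw [turanian_comm]
    exact this (by omega) (by omega)
  have key := fun {a b : ℕ} (h : CatFormSign a b) =>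
    coeff_turanian_catCoeff_of_catFormSign hpos hu hμ h N
  rcases Nat.eq_zero_or_pos a with rfl | ha
  · rw [Nat.cast_zero, turanian_zero, map_zero]
  · obtain ⟨rfl, rfl⟩ | ⟨rfl, rfl⟩ | ⟨rfl, rfl⟩ | ⟨rfl, rfl⟩ :
        a = 1 ∧ b = 1 ∨ a = 1 ∧ b = 2 ∨ a = 1 ∧ b = 3 ∨ a = 2 ∧ b = 2 := by omega
    · exact key catForm_sign_one_one
    · exact key catForm_sign_one_two
    · exact key catForm_sign_one_three
    · exact key catForm_sign_two_two

/-! ### Integer shifts at a point -/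

lemma catCoeff_mono {μ ν : ℝ} (hμ : 0 ≤ μ) (hν : μ ≤ ν) (n : ℕ) :
    catCoeff n μ ≤ catCoeff n ν := by
  cases n with
  | zero => simp [catCoeff, catPoly_zero_eval]
  | succ n =>
    simp only [catCoeff, catPoly_succ_eval]
    have h1 := rising_mono (show 0 ≤ μ + n + 2 by positivity)
      (show μ + n + 2 ≤ ν + n + 2 by linarith) n
    have h2 := rising_nonneg (show 0 ≤ μ + n + 2 by positivity) n
    have h3 := hμ.trans hν
    gcongr

lemma coeffNonneg_weightedSeries_catCoeff {u : ℕ → ℝ} (hu : ∀ n, 0 ≤ u n) {μ : ℝ} (hμ : 0 ≤ μ) :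
    CoeffNonneg (weightedSeries u catCoeff μ) := fun n => by
  rw [weightedSeries, PowerSeries.coeff_mk]
  exact mul_nonneg (hu n) (catPoly_eval_nonneg hμ n)

lemma convergesAt_weightedSeries_catCoeff_mono {u : ℕ → ℝ} (hu : ∀ n, 0 ≤ u n) {μ ν x : ℝ}
    (hμ : 0 ≤ μ) (hν : μ ≤ ν) (hx : 0 ≤ x)
    (h : ConvergesAt (weightedSeries u catCoeff ν) x) :
    ConvergesAt (weightedSeries u catCoeff μ) x := by
  refine Summable.of_nonneg_of_le
    (fun n => mul_nonneg (coeffNonneg_weightedSeries_catCoeff hu hμ n) (pow_nonneg hx n))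
    (fun n => ?_) h
  simp only [weightedSeries, PowerSeries.coeff_mk]
  have h1 := catCoeff_mono hμ hν n
  have h2 := hu n
  gcongr

/-- The Turán inequality for the shifts `(1, 1)` makes `j ↦ F(μ + j; x)` a positive log-concave
sequence, which gives the inequality for all integer shifts. -/
lemma logConcave_weightedSeries_catCoeff {u : ℕ → ℝ} (hpos : ∀ n, 0 < u n)
    (hu : ∀ n, u n * u (n + 2) ≤ u (n + 1) ^ 2) {x μ : ℝ} (hx : 0 ≤ x) (hμ : 0 ≤ μ) (m n : ℕ)
    (hconv : ConvergesAt (weightedSeries u catCoeff (μ + (m + n : ℕ))) x) :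
    sumAt (weightedSeries u catCoeff μ) x * sumAt (weightedSeries u catCoeff (μ + (m + n : ℕ))) x ≤
      sumAt (weightedSeries u catCoeff (μ + m)) x *
        sumAt (weightedSeries u catCoeff (μ + n)) x := by
  have hnn : ∀ μ, 0 ≤ μ → CoeffNonneg (weightedSeries u catCoeff μ) := fun μ hμ =>
    coeffNonneg_weightedSeries_catCoeff (fun n => (hpos n).le) hμ
  have hc : ∀ j ≤ m + n, ConvergesAt (weightedSeries u catCoeff (μ + (j : ℕ))) x := fun j hj =>
    convergesAt_weightedSeries_catCoeff_mono (fun n => (hpos n).le) (by positivity)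
      (by gcongr) hx hconv
  have hS : ∀ j ≤ m + n, 0 < sumAt (weightedSeries u catCoeff (μ + (j : ℕ))) x := by
    intro j hj
    refine (hc j hj).tsum_pos
      (fun k => mul_nonneg (hnn _ (by positivity) k) (pow_nonneg hx k)) 0 ?_
    simpa [weightedSeries, catCoeff, catPoly_zero_eval] using hpos 0
  have h := mul_le_mul_of_logConcave (M := m + n)
    (u := fun j => sumAt (weightedSeries u catCoeff (μ + (j : ℕ))) x) hS (fun j hj => ?_)
    (k := 0) (l := m + n) (k' := m) (l' := n) (by omega) (by simp) (by omega)
  · simpa using h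
  · have e : ∀ i j : ℕ, μ + (i : ℝ) + (j : ℝ) = μ + ((i + j : ℕ) : ℝ) := by
      intro i j; push_cast; ring
    have ht := hasSum_turanian hnn (α := ((1 : ℕ) : ℝ)) (β := ((1 : ℕ) : ℝ)) hx
      (show 0 ≤ μ + j by positivity) (by positivity) (by positivity)
      (hc j (by omega)) (by rw [e]; exact hc _ (by omega)) (by rw [e]; exact hc _ (by omega))
      (by rw [e, e]; exact hc _ (by omega))
    have h0 := ht.nonneg fun k => mul_nonneg
      (coeff_turanian_catCoeff_nonneg hpos hu (show 0 ≤ μ + j by positivity)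
        (show 1 + 1 ≤ 4 by norm_num) k) (pow_nonneg hx k)
    rw [e, e, show j + 1 + 1 = j + 2 by ring] at h0
    linarith

end FoxWrightTuran

end

open FoxWrightTuran in
theorem mainTheorem8 {p q : ℕ} (A a : Fin p → ℝ) (B b : Fin q → ℝ) (θ : ℝ)
    (hA : ∀ i, 0 < A i) (ha : ∀ i, 0 < a i) (hB : ∀ j, 0 < B j) (hb : ∀ j, 0 < b j)
    (hθ : 0 < θ) (hV : FoxWrightTuran.ParameterConditions A a B b θ) :
    FoxWrightTuran.CoeffwiseLogConvex (FoxWrightTuran.gSeries A a B b θ) ∧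
    FoxWrightTuran.CoeffwiseLogConcave (FoxWrightTuran.fSeries A a B b θ) ∧
    FoxWrightTuran.CoeffwiseLogConcaveForShifts (FoxWrightTuran.hSeries A a B b θ)
      FoxWrightTuran.integerShiftsSumLeFour ∧
    FoxWrightTuran.LogConcaveForShifts (FoxWrightTuran.hSeries A a B b θ)
      FoxWrightTuran.integerShifts ∧
    FoxWrightTuran.CoeffwiseLogConvexForShifts (FoxWrightTuran.hHatSeries A a B b θ)
      FoxWrightTuran.integerShiftsSumLeFour ∧
    FoxWrightTuran.LogConvexForShifts (FoxWrightTuran.hHatSeries A a B b θ)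
      FoxWrightTuran.integerShifts := by
  have hP := kernelNonneg_of_parameterConditions hA hB hV
  have hM : V A a B b θ ∈ momentCone := V_mem_momentCone hA ha hB hb hθ hP
  have hVpos : ∀ n, 0 < V A a B b θ n := by
    have hg : ∀ {r : ℕ} (C c : Fin r → ℝ), (∀ i, 0 < C i) → (∀ i, 0 < c i) → ∀ n : ℕ,
        0 < gammaProd C c n := fun C c hC hc n => Finset.prod_pos fun i _ =>
      Real.Gamma_pos_of_pos (add_pos_of_nonneg_of_pos (mul_nonneg (hC i).le n.cast_nonneg) (hc i))
    exact fun n => div_pos (hg A a hA ha n) (mul_pos (pow_pos hθ n) (hg B b hB hb n))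
  -- the reciprocal weights are log-concave
  set u : ℕ → ℝ := fun n => 1 / V A a B b θ n with hu_def
  have hpos : ∀ n, 0 < u n := fun n => one_div_pos.2 (hVpos n)
  have hu : ∀ n, u n * u (n + 2) ≤ u (n + 1) ^ 2 := by
    intro n
    simp only [hu_def]
    rw [one_div_mul_one_div, one_div_pow]
    exact one_div_le_one_div_of_le (pow_pos (hVpos _) 2) (sq_le_mul_of_mem_momentCone hM n)
  have eg : ∀ μ, gSeries A a B b θ μ =
      weightedSeries (V A a B b θ) (fun n μ => (binomPoly (2 * n)).eval μ) μ := by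
    intro μ
    ext n
    simp only [gSeries, weightedSeries, PowerSeries.coeff_mk, binomPoly_eval, V, one_div_pow]
    ring
  have ef : ∀ μ, fSeries A a B b θ μ = PowerSeries.X * weightedSeries u evenRisingCoeff μ := by
    intro μ
    ext n
    cases n with
    | zero => simp [fSeries]
    | succ n =>
      rw [PowerSeries.coeff_succ_X_mul]
      simp only [fSeries, weightedSeries, PowerSeries.coeff_mk, evenRisingCoeff, hu_def,
        Nat.succ_ne_zero, if_false, Nat.add_sub_cancel]
      rw [show 2 * (n + 1) - 1 = 2 * n + 1 by omega, show 2 * (n + 1) = 2 * n + 2 by ring,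
        div_mul_div_comm, one_mul]
  have eh : ∀ μ, 0 ≤ μ → hSeries A a B b θ μ = weightedSeries u catCoeff μ := by
    intro μ hμ
    ext n
    simp only [hSeries, weightedSeries, PowerSeries.coeff_mk, catCoeff, catPoly_eval hμ, hu_def, V,
      one_div_div]
    ring
  have ehh : ∀ μ, 0 ≤ μ → hHatSeries A a B b θ μ = weightedSeries (V A a B b θ) catCoeff μ := by
    intro μ hμ
    ext n
    simp only [hHatSeries, weightedSeries, PowerSeries.coeff_mk, catCoeff, catPoly_eval hμ, V,
      one_div_pow]
    ring
  have hhat : ∀ μ α β : ℝ, 0 ≤ μ → 0 ≤ α → 0 ≤ β → ∀ k,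
      PowerSeries.coeff k (turanian (hHatSeries A a B b θ) μ α β) ≤ 0 := by
    intro μ α β hμ hα hβ k
    rw [turanian_congr ehh hμ hα hβ]
    exact coeff_turanian_catSeries_nonpos hM hμ hα hβ k
  refine ⟨?_, ?_, ?_, ?_, ?_, ?_⟩
  · intro μ α β hμ hα hβ _ k
    rw [turanian_congr (fun μ _ => eg μ) hμ hα hβ]
    exact coeff_turanian_binomSeries_nonpos hM hμ hα hβ k
  · intro μ α β hμ hα hβ _ k
    have e : turanian (fSeries A a B b θ) μ α β =
        PowerSeries.X ^ 2 * turanian (weightedSeries u evenRisingCoeff) μ α β := by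
      simp only [turanian, ef]
      ring
    rw [e, PowerSeries.coeff_X_pow_mul']
    split_ifs
    · exact coeff_turanian_evenRising_nonneg hpos hu hμ hα hβ _
    · exact le_rfl
  · rintro μ α β hμ hα hβ ⟨m, n, hmn, hs⟩ k
    obtain ⟨rfl, rfl⟩ := Prod.mk.inj hs
    rw [turanian_congr eh hμ hα hβ]
    exact coeff_turanian_catCoeff_nonneg hpos hu hμ hmn k
  · rintro x μ α β hx hμ hα hβ ⟨m, n, hs⟩ - - - h3
    obtain ⟨rfl, rfl⟩ := Prod.mk.inj hs
    have e : μ + (m : ℝ) + n = μ + (m + n : ℕ) := by push_cast; ring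
    rw [e, eh _ (by positivity)] at h3
    rw [e, eh _ hμ, eh _ (by positivity), eh _ (by positivity), eh _ (by positivity), sub_nonneg]
    exact logConcave_weightedSeries_catCoeff hpos hu hx hμ m n h3
  · intro μ α β hμ hα hβ _ k
    exact hhat μ α β hμ hα hβ k
  · intro x μ α β hx hμ hα hβ _ h0 h1 h2 h3
    have hnn : ∀ μ, 0 ≤ μ → CoeffNonneg (hHatSeries A a B b θ μ) := fun μ hμ => by
      rw [ehh μ hμ]
      exact coeffNonneg_weightedSeries_catCoeff (fun n => (hVpos n).le) hμ
    exact (hasSum_turanian hnn hx hμ hα hβ h0 h1 h2 h3).nonpos fun k =>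
      mul_nonpos_of_nonpos_of_nonneg (hhat μ α β hμ hα hβ k) (pow_nonneg hx k)
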